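/- Let $\mathbb{T}=\mathbb{R}/2\mathbb{Z}$ carry Lebesgue measure (total mass $2$), and let $p_t(z)=(4\pi t)^{-1/2}\sum_{n\in\mathbb{Z}}e^{-(z+2n)^2/(4t)}$ be its heat kernel. Let $\dot W$ be space-time white noise on $(0,\infty)\times\mathbb{T}$. For a Lipschitz function $\sigma:\mathbb{R}\to\mathbb{R}$ with $\sigma(0)=0$ and an initial profile $u_0$ that is either non-random or random and independent of the noise, let $u$ denote the continuous random-field solution of $$\partial_t u(t,x)=\partial_x^2u(t,x)+\sigma(u(t,x))\,\dot W(t,x)\quad\text{on }(0,\infty)\times\mathbb{T},\qquad u(0)=u_0,$$ that is, the adapted, almost surely continuous random field on $[0,\infty)\times\mathbb{T}$ with $u(0)=u_0$ and $\sup_{t\in[0,T],\,x\in\mathbb{T}}\mathrm{E}\,|u(t,x)|^2<\infty$ for every $T>0$, such that for all $t>0$ and $x\in\mathbb{T}$, almost surely, $$u(t,x)=\int_{\mathbb{T}}p_t(x-y)u_0(y)\,dy+\int_{(0,t)\times\mathbb{T}}p_{t-s}(x-y)\,\sigma(u(s,y))\,W(ds\,dy),$$ where the last integral is a Walsh stochastic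 integral. **Proposition 3.7.** For every $\varpi>0$ and $\frac43<\gamma<2$ there exists a real number $K=K(\gamma,\varpi)>0$ such that $$\mathrm{P}\left\{\left\|u\left(N^{-\gamma}\right)\right\|_{L^\infty(\mathbb{T})}\ge K N^{\gamma/2}\right\}\le K\exp\left(-N^{(3\gamma-4)/2}\right),$$ $$\mathrm{P}\left\{\sup_{0\le s\le N^{-\gamma}}\|u(s)\|_{L^\infty(\mathbb{T})}\ge 2N\right\}\le K\exp\left(-\tfrac12 N^{(3\gamma-4)/2}\right),$$ uniformly for all real numbers $N\ge1$, all Lipschitz-continuous functions $\sigma:\mathbb{R}\to\mathbb{R}$ with $\sigma(0)=0$ and Lipschitz constant at most $\varpi$, and all continuous $u_0:\mathbb{T}\to[0,\infty)$ that satisfy (almost surely, if $u_0$ is random) $\|u_0\|_{L^1(\mathbb{T})}=1$ and $\|u_0\|_{L^\infty(\mathbb{T})}\le N$. -/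

import Mathlib

open MeasureTheory ProbabilityTheory Set Filter Topology
open scoped NNReal ENNReal

noncomputable section

namespace SHE

instance fact_two_pos : Fact ((0 : ℝ) < 2) := ⟨two_pos⟩

/-- The one-dimensional torus `ℝ / 2ℤ`; its `volume` is Lebesgue measure, of total mass `2`. -/
abbrev Torus : Type := AddCircle (2 : ℝ)

/-- The heat kernel of the Laplace operator on the torus,
`p_t(z) = (4πt)^(-1/2) ∑_{n ∈ ℤ} exp(-(z + 2n)² / (4t))`, meaningful for `t > 0`.
The point `z` is replaced by its representative in `[-1, 1)`; by periodicity of the sum, any other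
representative gives the same value. -/
def heatKernel (t : ℝ) (z : Torus) : ℝ :=
  (√(4 * Real.pi * t))⁻¹ *
    ∑' n : ℤ, Real.exp (-(((AddCircle.equivIco 2 (-1) z : ℝ) + 2 * n) ^ 2) / (4 * t))

/-- The heat semigroup `(P_t f)(x) = ∫ p_t(x - y) f(y) dy`, meaningful for `t > 0`. -/
def heatSemigroup (t : ℝ) (f : Torus → ℝ) (x : Torus) : ℝ :=
  ∫ y, heatKernel t (x - y) * f y

/-- Lebesgue measure on `(0, ∞) × Torus`. -/
def spaceTime : Measure (ℝ × Torus) :=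
  (volume.restrict (Ioi (0 : ℝ))).prod volume

variable {Ω : Type*} {m : MeasurableSpace Ω}

/-- `W` is a space-time white noise on `(0, ∞) × Torus` relative to the filtration `F`:
a centred Gaussian family indexed by the Borel sets of finite Lebesgue measure, with
`Cov(W(A), W(B)) = |A ∩ B|`, adapted to `F`, whose future is independent of the past.
Only the values of `F` at times `t ≥ 0` and of `W` at Borel sets of finite measure matter. -/
structure IsWhiteNoise (W : Set (ℝ × Torus) → Ω → ℝ) (F : Filtration ℝ m) (P : Measure Ω) :
    Prop where
  measurable : ∀ A, MeasurableSet A → spaceTime A < ∞ → Measurable (W A)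
  gaussian : IsGaussianProcess
    (fun A : {A : Set (ℝ × Torus) // MeasurableSet A ∧ spaceTime A < ∞} ↦ W A.1) P
  mean : ∀ A, MeasurableSet A → spaceTime A < ∞ → ∫ ω, W A ω ∂P = 0
  covariance : ∀ A B, MeasurableSet A → spaceTime A < ∞ → MeasurableSet B → spaceTime B < ∞ →
    cov[W A, W B; P] = (spaceTime (A ∩ B)).toReal
  adapted : ∀ t : ℝ, 0 ≤ t → ∀ A, MeasurableSet A → A ⊆ Ioc 0 t ×ˢ univ →
    Measurable[F t] (W A)
  indep : ∀ t : ℝ, 0 ≤ t →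
    Indep (F t)
      (⨆ A ∈ {A : Set (ℝ × Torus) | MeasurableSet A ∧ spaceTime A < ∞ ∧ A ⊆ Ioi t ×ˢ univ},
        MeasurableSpace.comap (W A) inferInstance) P

/-- An elementary predictable random field `X(ω) 1_{(a, b]}(s) 1_A(y)`, with `X` bounded and
measurable with respect to the filtration at time `a`. -/
structure Elementary (F : Filtration ℝ m) where
  a : ℝ
  b : ℝ
  a_nonneg : 0 ≤ a
  a_le_b : a ≤ b
  A : Set Torus
  measurableSet_A : MeasurableSet A
  X : Ω → ℝ
  measurable_X : Measurable[F a] X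
  bounded_X : ∃ C : ℝ, ∀ ω, |X ω| ≤ C

/-- The elementary field as a function of `(ω, (s, y))`. -/
def Elementary.toField {F : Filtration ℝ m} (e : Elementary F) (z : Ω × (ℝ × Torus)) : ℝ :=
  e.X z.1 * (Ioc e.a e.b ×ˢ e.A).indicator 1 z.2

/-- The stochastic integral `X · W((a, b] × A)` of an elementary field. -/
def Elementary.integral {F : Filtration ℝ m} (W : Set (ℝ × Torus) → Ω → ℝ) (e : Elementary F)
    (ω : Ω) : ℝ :=
  e.X ω * W (Ioc e.a e.b ×ˢ e.A) ω

/-- Simple predictable random fields: finite sums of elementary ones. -/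
abbrev Simple (F : Filtration ℝ m) := List (Elementary F)

/-- The simple field as a function of `(ω, (s, y))`. -/
def Simple.toField {F : Filtration ℝ m} (Φ : Simple F) (z : Ω × (ℝ × Torus)) : ℝ :=
  (Φ.map fun e ↦ e.toField z).sum

/-- The stochastic integral of a simple field. -/
def Simple.integral {F : Filtration ℝ m} (W : Set (ℝ × Torus) → Ω → ℝ) (Φ : Simple F)
    (ω : Ω) : ℝ :=
  (Φ.map fun e ↦ e.integral W ω).sum

/-- `I` is (a version of) the Walsh stochastic integral `∫ h dW` over `(0, ∞) × Torus`:
the square-integrable field `h` is the limit in `L²(P ⊗ ds dy)` of simple predictable fields whose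
integrals converge to `I` in `L²(P)`. -/
structure IsWalshIntegral (W : Set (ℝ × Torus) → Ω → ℝ) (F : Filtration ℝ m) (P : Measure Ω)
    (h : Ω × (ℝ × Torus) → ℝ) (I : Ω → ℝ) : Prop where
  memLp_field : MemLp h 2 (P.prod spaceTime)
  memLp_integral : MemLp I 2 P
  approx : ∃ Φ : ℕ → Simple F,
    Tendsto (fun n ↦ eLpNorm (fun z ↦ (Φ n).toField z - h z) 2 (P.prod spaceTime)) atTop (𝓝 0) ∧
    Tendsto (fun n ↦ eLpNorm (fun ω ↦ (Φ n).integral W ω - I ω) 2 P) atTop (𝓝 0)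

/-- `u` is the continuous random-field (mild) solution of
`∂ₜ u = ∂ₓ² u + σ(u) Ẇ` on `(0, ∞) × Torus` with initial profile `u₀`: an adapted, almost surely
continuous random field, bounded in `L²(P)` on bounded time intervals, such that, for all `t > 0`
and `x`, almost surely,
`u(t, x) = (P_t u₀)(x) + ∫_{(0, t) × Torus} p_{t - s}(x - y) σ(u(s, y)) W(ds dy)`.
The initial profile may be random; being measurable at time `0`, it is independent of the noise.
Only the values `u t` at times `t ≥ 0` matter. -/
structure IsMildSolution (W : Set (ℝ × Torus) → Ω → ℝ) (F : Filtration ℝ m) (P : Measure Ω)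
    (σ : ℝ → ℝ) (u₀ : Ω → C(Torus, ℝ)) (u : ℝ → Torus → Ω → ℝ) : Prop where
  initial_measurable : ∀ x, Measurable[F 0] fun ω ↦ u₀ ω x
  initial : ∀ᵐ ω ∂P, ∀ x, u 0 x ω = u₀ ω x
  adapted : ∀ t : ℝ, 0 ≤ t → ∀ x, Measurable[F t] (u t x)
  continuous : ∀ᵐ ω ∂P,
    ContinuousOn (fun z : ℝ × Torus ↦ u z.1 z.2 ω) (Ici 0 ×ˢ univ)
  moment : ∀ T : ℝ, ∃ C : ℝ≥0, ∀ t ∈ Icc 0 T, ∀ x, ∫⁻ ω, ‖u t x ω‖ₑ ^ 2 ∂P ≤ C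
  mild : ∀ t : ℝ, 0 < t → ∀ x,
    IsWalshIntegral W F P
      (fun z ↦ if z.2.1 < t then heatKernel (t - z.2.1) (x - z.2.2) * σ (u z.2.1 z.2.2 z.1) else 0)
      (fun ω ↦ u t x ω - heatSemigroup t (u₀ ω) x)

end SHE

end

/-! Write t = N^{-γ} and split the mild solution into `heatSemigroup` plus `noisePart`. The
deterministic part lies in [0, N] by the maximum principle and, since the initial mass is 1, it is
at most p_t(0) ≲ t^{-1/2} = N^{γ/2} at time t. So everything rests on a uniform bound for the
stochastic convolution up to time t.

As long as |u| ≤ 2N, the integrand satisfies |σ(u)| ≤ 2ϖN, and the quadratic variation of an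
increment of the convolution is at most (2ϖN)² times the squared L² distance of two heat kernels
(`exists_lintegral_mildKernel_sub_le`, by Fourier series). A Walsh integral has Gaussian tails on
the event that its quadratic variation is small (`IsWalshIntegral.measure_abs_ge_le`). This comes
from exponential martingales of simple fields, Fatou's lemma and a Chernoff bound. Chaining over a
parabolically scaled grid (`exists_measure_chainBad_le`, `exists_abs_noisePart_le`) then bounds the
convolution by a, off an event of probability at most a constant times t^{-1/2} z^{-13} e^{-z/2},
where z is a constant multiple of a²/(N²√t).

No stopping time is needed. The bad events in `chainBad` ask for a large increment together with a
small quadratic variation, so their probability is controlled without any bound on u. Off the bad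
event for a = N/2, a pathwise first-exit argument (`abs_le_of_noisePart_le`) shows that |u| cannot
reach 2N before time t: at the first hitting time the bound N + N/2 would hold. Here z is of order
N^{γ/2}, which beats N^{(3γ-4)/2} because γ < 2.

With |u| ≤ 2N secured, the choice a = K₁N^{γ/2} makes z equal to a multiple of N^{(3γ-4)/2}, which
grows because γ > 4/3. This gives the sharper bound at time t. -/

noncomputable section

/-! ### Fourier series of the heat kernel on the torus. -/

namespace SHE

/-- The Fourier multiplier `e^{-π² n² t}` of the heat semigroup on the torus. -/
def heatCoeff (t : ℝ) (n : ℤ) : ℝ := Real.exp (-(Real.pi ^ 2 * (n : ℝ) ^ 2 * t))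

lemma heatCoeff_pos (t : ℝ) (n : ℤ) : 0 < heatCoeff t n := Real.exp_pos _

lemma heatCoeff_add (s t : ℝ) (n : ℤ) : heatCoeff (s + t) n = heatCoeff s n * heatCoeff t n := by
  rw [heatCoeff, heatCoeff, heatCoeff, ← Real.exp_add]
  ring_nf

lemma heatCoeff_neg (t : ℝ) (n : ℤ) : heatCoeff t (-n) = heatCoeff t n := by
  simp [heatCoeff]

lemma heatCoeff_anti {s t : ℝ} (h : s ≤ t) (n : ℤ) : heatCoeff t n ≤ heatCoeff s n := by
  unfold heatCoeff
  gcongr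

lemma heatKernel_eq_evenKernel {t : ℝ} (ht : 0 < t) (z : Torus) :
    heatKernel t z = (√(4 * Real.pi * t))⁻¹ * HurwitzZeta.evenKernel
      (((AddCircle.equivIco 2 (-1) z : ℝ) / 2 : ℝ) : UnitAddCircle) (1 / (Real.pi * t)) := by
  unfold heatKernel
  rw [← (HurwitzZeta.hasSum_int_evenKernel _ (by positivity)).tsum_eq]
  congr 2
  ext n
  congr 1
  field_simp
  ring

/-- Poisson summation, in the form of the functional equation of the Jacobi theta function. All
later kernel estimates are made coefficient by coefficient on this series. -/
lemma hasSum_heatKernel_complex {t : ℝ} (ht : 0 < t) (z : Torus) :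
    HasSum (fun n : ℤ ↦ ((heatCoeff t n / 2 : ℝ) : ℂ) * fourier n z) (heatKernel t z : ℂ) := by
  set a : ℝ := (AddCircle.equivIco 2 (-1) z : ℝ) with ha
  have hz : z = (a : Torus) := (AddCircle.coe_equivIco (p := (2 : ℝ)) (a := -1) (y := z)).symm
  have key : heatKernel t z = HurwitzZeta.cosKernel ((a / 2 : ℝ) : UnitAddCircle) (Real.pi * t) / 2 := by
    rw [heatKernel_eq_evenKernel ht, ← ha, HurwitzZeta.evenKernel_functional_equation,
      ← Real.sqrt_eq_rpow, one_div_one_div, one_div, one_div, mul_assoc 4,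
      Real.sqrt_mul (by norm_num), Real.sqrt_inv, inv_inv, show √(4 : ℝ) = 2 by
        rw [show (4 : ℝ) = 2 ^ 2 by norm_num]; exact Real.sqrt_sq (by norm_num)]
    have : √(Real.pi * t) ≠ 0 := by positivity
    field_simp
  have h := (HurwitzZeta.hasSum_int_cosKernel (a / 2) (t := Real.pi * t) (by positivity)).div_const 2
  rw [key]
  push_cast
  convert! h using 2 with n
  rw [hz, fourier_coe_apply, heatCoeff]
  have e1 : Complex.exp (2 * ↑Real.pi * Complex.I * ↑n * ↑a / ↑(2 : ℝ))
      = Complex.exp (2 * ↑Real.pi * Complex.I * ↑(a / 2) * ↑n) := by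
    congr 1
    push_cast
    ring
  have e2 : -(Real.pi ^ 2 * (n : ℝ) ^ 2 * t) = -Real.pi * (n : ℝ) ^ 2 * (Real.pi * t) := by ring
  rw [e1, e2]
  push_cast
  ring

lemma hasSum_heatKernel {t : ℝ} (ht : 0 < t) (z : Torus) :
    HasSum (fun n : ℤ ↦ heatCoeff t n / 2 * (fourier n z).re) (heatKernel t z) := by
  have := Complex.hasSum_re (hasSum_heatKernel_complex ht z)
  simpa [Complex.mul_re] using this

lemma hasSum_heatKernel_zero {t : ℝ} (ht : 0 < t) :
    HasSum (fun n : ℤ ↦ heatCoeff t n / 2) (heatKernel t 0) := by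
  simpa using hasSum_heatKernel ht 0

lemma summable_heatCoeff {t : ℝ} (ht : 0 < t) : Summable (heatCoeff t) := by
  simpa using (hasSum_heatKernel_zero ht).summable.mul_right 2

lemma norm_fourier (n : ℤ) (z : Torus) : ‖fourier n z‖ = 1 := by
  rw [fourier_apply]
  exact Circle.norm_coe _

lemma heatKernel_nonneg (t : ℝ) (z : Torus) : 0 ≤ heatKernel t z :=
  mul_nonneg (by positivity) (tsum_nonneg fun _ ↦ (Real.exp_pos _).le)

lemma heatKernel_le_zero {t : ℝ} (ht : 0 < t) (z : Torus) : heatKernel t z ≤ heatKernel t 0 := by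
  refine hasSum_le (fun n ↦ ?_) (hasSum_heatKernel ht z) (hasSum_heatKernel_zero ht)
  refine mul_le_of_le_one_right (by have := heatCoeff_pos t n; positivity) ?_
  exact (Complex.re_le_norm _).trans (norm_fourier n z).le

lemma heatKernel_zero_anti {s t : ℝ} (hs : 0 < s) (h : s ≤ t) :
    heatKernel t 0 ≤ heatKernel s 0 :=
  hasSum_le (fun n ↦ by have := heatCoeff_anti h n; linarith)
    (hasSum_heatKernel_zero (hs.trans_le h)) (hasSum_heatKernel_zero hs)

/-- The on-diagonal heat kernel bound `p_t(0) ≤ C t^{-1/2}` for small times. -/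
lemma exists_heatKernel_zero_le : ∃ C : ℝ, 0 < C ∧ ∀ t : ℝ, 0 < t → t ≤ 2 →
    heatKernel t 0 ≤ C / √t := by
  have h2 := HurwitzZeta.hasSum_int_evenKernel 0 (t := 1 / (Real.pi * 2)) (by positivity)
  refine ⟨HurwitzZeta.evenKernel ((0 : ℝ) : UnitAddCircle) (1 / (Real.pi * 2)), ?_,
    fun t ht ht2 ↦ ?_⟩
  · have h0 := hasSum_lt (i := (0 : ℤ)) (fun n ↦ (Real.exp_pos _).le) (Real.exp_pos _) hasSum_zero h2
    exact h0
  · have h1 := HurwitzZeta.hasSum_int_evenKernel 0 (t := 1 / (Real.pi * t)) (by positivity)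
    -- Apart from the factor (4πt)^{-1/2}, the Gaussian sum at 0 increases with t, so its value at t
    -- = 2 serves as the constant.
    have hle : HurwitzZeta.evenKernel ((0 : ℝ) : UnitAddCircle) (1 / (Real.pi * t)) ≤
        HurwitzZeta.evenKernel ((0 : ℝ) : UnitAddCircle) (1 / (Real.pi * 2)) := by
      refine hasSum_le (fun n ↦ ?_) h1 h2
      simp only [neg_mul]
      gcongr
    have hz : ((AddCircle.equivIco 2 (-1) (0 : Torus) : ℝ)) = 0 := by
      have : (0 : Torus) = ((0 : ℝ) : Torus) := rfl
      rw [this, AddCircle.equivIco_coe_eq (by norm_num)]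
    rw [heatKernel_eq_evenKernel ht, hz, zero_div, div_eq_inv_mul _ (√t)]
    have hnn : 0 ≤ HurwitzZeta.evenKernel ((0 : ℝ) : UnitAddCircle) (1 / (Real.pi * t)) :=
      h1.nonneg fun n ↦ (Real.exp_pos _).le
    have : t ≤ 4 * Real.pi * t := by nlinarith [Real.pi_gt_three]
    have h3 : (√(4 * Real.pi * t))⁻¹ ≤ (√t)⁻¹ := by gcongr
    exact mul_le_mul h3 hle hnn (by positivity)

lemma continuousOn_heatKernel :
    ContinuousOn (fun q : ℝ × Torus ↦ heatKernel q.1 q.2) (Ioi 0 ×ˢ univ) := by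
  intro q hq
  have hq1 : 0 < q.1 := hq.1
  have hc : ContinuousOn (fun q : ℝ × Torus ↦ ∑' n : ℤ, heatCoeff q.1 n / 2 * (fourier n q.2).re)
      (Ioi (q.1 / 2) ×ˢ univ) := by
    refine continuousOn_tsum (u := fun n ↦ heatCoeff (q.1 / 2) n) (fun n ↦ ?_)
      (summable_heatCoeff (by positivity)) (fun n p hp ↦ ?_)
    · unfold heatCoeff
      have : Continuous (fun z : Torus ↦ fourier n z) := (fourier n).continuous
      fun_prop
    · have h1 := heatCoeff_anti (le_of_lt hp.1) n
      have h2 := heatCoeff_pos p.1 n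
      rw [norm_mul, Real.norm_of_nonneg (by positivity), Real.norm_eq_abs]
      have h3 := (Complex.abs_re_le_norm (fourier n p.2)).trans (norm_fourier n p.2).le
      nlinarith [abs_nonneg (fourier n p.2).re]
  have hc' : ContinuousOn (fun q : ℝ × Torus ↦ heatKernel q.1 q.2) (Ioi (q.1 / 2) ×ˢ univ) := by
    refine hc.congr fun p hp ↦ ?_
    have hp1 : q.1 / 2 < p.1 := hp.1
    exact (hasSum_heatKernel (by linarith) p.2).tsum_eq.symm
  refine (hc'.continuousAt ?_).continuousWithinAt
  exact (isOpen_Ioi.prod isOpen_univ).mem_nhds ⟨by simp only [mem_Ioi]; linarith, mem_univ _⟩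

lemma continuous_heatKernel {t : ℝ} (ht : 0 < t) : Continuous (heatKernel t) := by
  have := continuousOn_heatKernel.comp_continuous (f := fun z : Torus ↦ (t, z)) (by fun_prop)
    (fun z ↦ ⟨ht, mem_univ _⟩)
  exact this

lemma integral_fourier (n : ℤ) : ∫ y : Torus, fourier n y = if n = 0 then 2 else 0 := by
  split_ifs with h
  · subst h
    simp [Measure.real, AddCircle.measure_univ]
  · exact integral_eq_zero_of_add_right_eq_neg (g := ((2 / 2 / n : ℝ) : Torus))
      (fun x ↦ fourier_add_half_inv_index h (by norm_num) x)

lemma fourier_sub' (n : ℤ) (x y : Torus) : fourier n (x - y) = fourier n x * fourier (-n) y := by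
  rw [fourier_apply, fourier_apply, fourier_apply, ← Circle.coe_mul, ← AddCircle.toCircle_add]
  congr 2
  rw [smul_sub, neg_smul, sub_eq_add_neg]

lemma hasSum_integral_mul_heatKernel {t : ℝ} (ht : 0 < t) (f : C(Torus, ℂ)) (x : Torus) :
    HasSum (fun n : ℤ ↦ ((heatCoeff t n / 2 : ℝ) : ℂ) * ∫ y, f y * fourier n (x - y))
      (∫ y, f y * (heatKernel t (x - y) : ℂ)) := by
  have hF : ∀ n : ℤ, Continuous
      fun y : Torus ↦ ((heatCoeff t n / 2 : ℝ) : ℂ) * (f y * fourier n (x - y)) := fun n ↦ by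
    have := (fourier (T := 2) n).continuous
    fun_prop
  have h := hasSum_integral_of_summable_integral_norm (μ := (volume : Measure Torus))
    (F := fun (n : ℤ) y ↦ ((heatCoeff t n / 2 : ℝ) : ℂ) * (f y * fourier n (x - y)))
    (fun n ↦ (hF n).integrable_of_hasCompactSupport (HasCompactSupport.of_compactSpace _)) ?_
  · simp only [integral_const_mul] at h
    convert! h using 1
    congr 1
    ext y
    rw [← (hasSum_heatKernel_complex ht (x - y)).tsum_eq, ← tsum_mul_left]
    congr 1
    ext n
    ring
  · refine Summable.of_nonneg_of_le (fun n ↦ integral_nonneg fun y ↦ norm_nonneg _) (fun n ↦ ?_)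
      ((summable_heatCoeff ht).mul_right ‖f‖)
    have hb : ∀ y : Torus, ‖((heatCoeff t n / 2 : ℝ) : ℂ) * (f y * fourier n (x - y))‖ ≤
        heatCoeff t n / 2 * ‖f‖ := fun y ↦ by
      have := heatCoeff_pos t n
      rw [norm_mul, norm_mul, norm_fourier, mul_one, Complex.norm_real,
        Real.norm_of_nonneg (by positivity)]
      gcongr
      exact f.norm_coe_le_norm y
    have h1 := integral_mono (μ := (volume : Measure Torus))
      ((hF n).norm.integrable_of_hasCompactSupport (HasCompactSupport.of_compactSpace _))
      (integrable_const _) hb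
    refine h1.trans (le_of_eq ?_)
    simp [Measure.real, AddCircle.measure_univ]
    ring

/-- Characters are eigenfunctions of the heat semigroup: by orthogonality only the mode -n of the
kernel survives. Mode 0 gives total mass one, and all modes together give Chapman–Kolmogorov. -/
lemma integral_fourier_mul_heatKernel {t : ℝ} (ht : 0 < t) (n : ℤ) (x x' : Torus) :
    ∫ y, fourier n (x - y) * (heatKernel t (x' - y) : ℂ) = heatCoeff t n * fourier n (x - x') := by
  have h := hasSum_integral_mul_heatKernel ht
    ⟨fun y : Torus ↦ fourier n (x - y), by
      have := (fourier (T := 2) n).continuous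
      fun_prop⟩ x'
  have h2 : ∀ m : ℤ, m ≠ -n → ((heatCoeff t m / 2 : ℝ) : ℂ) *
      ∫ y : Torus, fourier n (x - y) * fourier m (x' - y) = 0 := fun m hm ↦ by
    have : ∀ y : Torus, fourier n (x - y) * fourier m (x' - y) =
        fourier n x * fourier m x' * fourier (-n + -m) y := fun y ↦ by
      rw [fourier_sub', fourier_sub', fourier_add]
      ring
    simp_rw [this]
    rw [integral_const_mul, integral_fourier, if_neg (by omega)]
    simp
  refine h.unique ?_
  convert! hasSum_single (-n) h2 using 1
  have : ∀ y : Torus, fourier n (x - y) * fourier (-n) (x' - y) = fourier n (x - x') := fun y ↦ by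
    rw [fourier_sub', fourier_sub', fourier_sub', neg_neg]
    have h1 : (fourier (-n) y : ℂ) * fourier n y = 1 := by
      rw [← fourier_add, neg_add_cancel, fourier_zero]
    linear_combination fourier n x * fourier (-n) x' * h1
  simp_rw [this]
  simp [Measure.real, AddCircle.measure_univ, heatCoeff_neg]
  ring

lemma heatKernel_neg {t : ℝ} (ht : 0 < t) (z : Torus) : heatKernel t (-z) = heatKernel t z := by
  refine (hasSum_heatKernel ht (-z)).unique ?_
  convert! hasSum_heatKernel ht z using 2 with n
  have : fourier n (-z) = starRingEnd ℂ (fourier n z) := by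
    rw [← fourier_neg, ← zero_sub, fourier_sub']
    simp
  rw [this, Complex.conj_re]

lemma integral_heatKernel {t : ℝ} (ht : 0 < t) (x : Torus) : ∫ y, heatKernel t (x - y) = 1 := by
  have h := integral_fourier_mul_heatKernel ht 0 x x
  simp only [fourier_zero, one_mul, mul_one] at h
  have h3 : ∫ y : Torus, ((heatKernel t (x - y) : ℝ) : ℂ) = ((∫ y, heatKernel t (x - y) : ℝ) : ℂ) :=
    integral_ofReal
  rw [h3] at h
  simpa [heatCoeff] using h

/-- The semigroup (Chapman–Kolmogorov) property of the heat kernel. -/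
lemma integral_heatKernel_mul_heatKernel {s t : ℝ} (hs : 0 < s) (ht : 0 < t) (x x' : Torus) :
    ∫ y, heatKernel s (x - y) * heatKernel t (x' - y) = heatKernel (s + t) (x - x') := by
  have hc := continuous_heatKernel hs
  have h := hasSum_integral_mul_heatKernel ht
    ⟨fun y : Torus ↦ (heatKernel s (x - y) : ℂ), by fun_prop⟩ x'
  have h3 : ∫ y : Torus, (heatKernel s (x - y) : ℂ) * (heatKernel t (x' - y) : ℂ) =
      ((∫ y, heatKernel s (x - y) * heatKernel t (x' - y) : ℝ) : ℂ) := by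
    have h3 := integral_ofReal (𝕜 := ℂ) (μ := (volume : Measure Torus))
      (f := fun y ↦ heatKernel s (x - y) * heatKernel t (x' - y))
    push_cast at h3
    exact h3
  have h4 : ∀ n : ℤ, ∫ y, ((heatKernel s (x - y) : ℝ) : ℂ) * fourier n (x' - y) =
      heatCoeff s n * fourier n (x' - x) := fun n ↦ by
    rw [← integral_fourier_mul_heatKernel hs]
    congr 1
    ext y
    ring
  simp only [ContinuousMap.coe_mk, h3, h4] at h
  have h5 := hasSum_heatKernel_complex (add_pos hs ht) (x' - x)
  rw [← Complex.ofReal_inj, ← heatKernel_neg (add_pos hs ht), neg_sub]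
  refine h.unique ?_
  convert! h5 using 2 with n
  rw [heatCoeff_add]
  push_cast
  ring

end SHE

end

/-! ### Mean-square continuity of the stochastic convolution kernel. -/

noncomputable section

namespace SHE

/-- The kernel `(r, y) ↦ p_{s - r}(x - y) 1_{r < s}` of the stochastic convolution. -/
def mildKernel (s : ℝ) (x : Torus) (z : ℝ × Torus) : ℝ :=
  if z.1 < s then heatKernel (s - z.1) (x - z.2) else 0

lemma fourier_re_coe (n : ℤ) (h : ℝ) :
    (fourier n (h : Torus)).re = Real.cos (Real.pi * n * h) := by
  have : 2 * (Real.pi : ℂ) * Complex.I * n * h / ((2 : ℝ) : ℂ)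
      = ((Real.pi * n * h : ℝ) : ℂ) * Complex.I := by
    push_cast
    ring
  rw [fourier_coe_apply, this, Complex.exp_ofReal_mul_I_re]

/-- Interpolating down to a fourth root gives up regularity so that the time singularity below stays
integrable. -/
lemma min_one_le_sqrt_sqrt {x : ℝ} (hx : 0 ≤ x) : min 1 x ≤ √√x := by
  rcases le_total 1 x with h | h
  · refine (min_le_left _ _).trans ?_
    simpa using h
  · refine (min_le_right _ _).trans ?_
    have : x ≤ √x := by
      refine Real.le_sqrt_of_sq_le ?_
      nlinarith
    exact this.trans (Real.sqrt_le_sqrt this)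

lemma one_sub_exp_neg_sq_le {x : ℝ} (hx : 0 ≤ x) : (1 - Real.exp (-x)) ^ 2 ≤ √√x := by
  refine le_trans ?_ (min_one_le_sqrt_sqrt hx)
  have h1 : Real.exp (-x) ≤ 1 := by simpa using hx
  have h2 := Real.exp_pos (-x)
  have h3 := Real.add_one_le_exp (-x)
  refine le_min ?_ ?_ <;> nlinarith

lemma one_sub_cos_le (θ : ℝ) : 1 - Real.cos θ ≤ 2 * √|θ| := by
  have h0 : √√(θ ^ 2) = √|θ| := by rw [Real.sqrt_sq_eq_abs]
  have h1 := min_one_le_sqrt_sqrt (sq_nonneg θ)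
  rw [h0] at h1
  have h2 := Real.one_sub_sq_div_two_le_cos (x := θ)
  have h3 := Real.neg_one_le_cos θ
  rcases min_choice 1 (θ ^ 2) with h | h <;> rw [h] at h1 <;> nlinarith [sq_nonneg θ]

lemma heatCoeff_mul_sqrt_le {r : ℝ} (hr : 0 < r) (n : ℤ) :
    heatCoeff r n * √(Real.pi * |(n : ℝ)|) ≤ 1 / √√r := by
  rw [le_div_iff₀ (by positivity), mul_assoc, ← Real.sqrt_mul (by positivity)]
  set Y := Real.pi * |(n : ℝ)| * √r with hY
  have hY0 : 0 ≤ Y := by positivity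
  have h1 : heatCoeff r n = Real.exp (-Y ^ 2) := by
    unfold heatCoeff
    rw [hY, mul_pow, mul_pow, sq_abs, Real.sq_sqrt hr.le]
  have h2 : √Y ≤ Real.exp (Y ^ 2) := by
    refine le_trans ?_ (Real.add_one_le_exp _)
    rw [Real.sqrt_le_iff]
    constructor
    · positivity
    · nlinarith [sq_nonneg (Y - 1), sq_nonneg Y, sq_nonneg (Y ^ 2)]
  rw [h1, Real.exp_neg]
  rw [inv_mul_le_iff₀ (Real.exp_pos _)]
  linarith

/-- Expand the square and apply Chapman–Kolmogorov to each product. -/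
lemma integral_sq_heatKernel_sub {a b : ℝ} (ha : 0 < a) (hb : 0 < b) (x x' : Torus) :
    ∫ y, (heatKernel a (x - y) - heatKernel b (x' - y)) ^ 2 =
      heatKernel (a + a) 0 + heatKernel (b + b) 0 - 2 * heatKernel (a + b) (x - x') := by
  have ca := continuous_heatKernel ha
  have cb := continuous_heatKernel hb
  have hi : ∀ f : Torus → ℝ, Continuous f → Integrable f volume := fun f hf ↦
    hf.integrable_of_hasCompactSupport (HasCompactSupport.of_compactSpace _)
  have h1 := integral_heatKernel_mul_heatKernel ha ha x x
  have h2 := integral_heatKernel_mul_heatKernel hb hb x' x'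
  rw [sub_self] at h1 h2
  rw [← h1, ← h2, ← integral_heatKernel_mul_heatKernel ha hb x x', ← integral_const_mul,
    ← integral_add (hi _ (by fun_prop)) (hi _ (by fun_prop)),
    ← integral_sub (hi _ (by fun_prop)) (hi _ (by fun_prop))]
  congr 1
  ext y
  ring

/-- Modewise, with g and E the multipliers of r and δ, the left side is g²/2 · ((1 - E)² + 2E(1 -
cos θ)). Each bracketed term is bounded by a multiple of √(π|n|) √(√δ + |h|), and one factor g
absorbs √(π|n|) at the price r^{-1/4}. The remaining g/2 sums to p_r(0) ≲ r^{-1/2}, for a total of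
r^{-3/4}. Spending a full power of |n| instead would give the non-integrable r^{-1}. -/
lemma heatKernel_increment_le {r δ : ℝ} (hr : 0 < r) (hδ : 0 ≤ δ) (x x' : Torus) (h : ℝ)
    (hx : x - x' = (h : Torus)) :
    ∫ y, (heatKernel (r + δ) (x - y) - heatKernel r (x' - y)) ^ 2 ≤
      5 * √(√δ + |h|) / √√r * heatKernel r 0 := by
  rw [integral_sq_heatKernel_sub (by linarith) hr, hx]
  have s1 := hasSum_heatKernel_zero (t := r + δ + (r + δ)) (by linarith)
  have s2 := hasSum_heatKernel_zero (t := r + r) (by linarith)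
  have s3 := hasSum_heatKernel (t := r + δ + r) (by linarith) (h : Torus)
  refine hasSum_le (fun n ↦ ?_) ((s1.add s2).sub (s3.mul_left 2))
    ((hasSum_heatKernel_zero hr).mul_left _)
  simp only [heatCoeff_add, fourier_re_coe]
  set g := heatCoeff r n
  set E := heatCoeff δ n with hE
  set θ := Real.pi * n * h with hθ
  have hg : 0 < g := heatCoeff_pos r n
  have hE0 : 0 < E := heatCoeff_pos δ n
  have hE1 : E ≤ 1 := (heatCoeff_anti hδ n).trans (by simp [heatCoeff])
  have e1 : (1 - E) ^ 2 ≤ √(Real.pi * |(n : ℝ)|) * √(√δ + |h|) := by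
    refine (one_sub_exp_neg_sq_le (by positivity)).trans ?_
    rw [← Real.sqrt_mul (by positivity)]
    apply Real.sqrt_le_sqrt
    have : Real.pi ^ 2 * (n : ℝ) ^ 2 * δ = (Real.pi * |(n : ℝ)|) ^ 2 * δ := by
      rw [mul_pow, sq_abs]
    rw [this, Real.sqrt_mul (by positivity), Real.sqrt_sq (by positivity)]
    gcongr
    linarith [abs_nonneg h]
  have e2 : 1 - Real.cos θ ≤ 2 * (√(Real.pi * |(n : ℝ)|) * √(√δ + |h|)) := by
    refine (one_sub_cos_le θ).trans ?_
    rw [← Real.sqrt_mul (by positivity), hθ, abs_mul, abs_mul, abs_of_pos Real.pi_pos]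
    gcongr
    linarith [Real.sqrt_nonneg δ]
  have e3 := heatCoeff_mul_sqrt_le hr n
  set S := √(Real.pi * |(n : ℝ)|)
  set H := √(√δ + |h|)
  have hS : 0 ≤ S := Real.sqrt_nonneg _
  have hH : 0 ≤ H := Real.sqrt_nonneg _
  have e4 : 0 ≤ 1 - Real.cos θ := by linarith [Real.cos_le_one θ]
  have e5 : E * (1 - Real.cos θ) ≤ 2 * (S * H) := by nlinarith
  calc g * E * (g * E) / 2 + g * g / 2 - 2 * (g * E * g / 2 * Real.cos θ)
      = g ^ 2 / 2 * ((1 - E) ^ 2 + 2 * (E * (1 - Real.cos θ))) := by ring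
    _ ≤ g ^ 2 / 2 * (5 * (S * H)) := by gcongr; linarith
    _ = 5 * H * (g / 2) * (g * S) := by ring
    _ ≤ 5 * H * (g / 2) * (1 / √√r) := by gcongr
    _ = _ := by ring

lemma lintegral_sub_rpow {a s α : ℝ} (h : a ≤ s) (hα : -1 < α) :
    ∫⁻ r in Ioo a s, ENNReal.ofReal ((s - r) ^ α) =
      ENNReal.ofReal ((s - a) ^ (α + 1) / (α + 1)) := by
  have hi : IntervalIntegrable (fun r : ℝ ↦ (s - r) ^ α) volume a s := by
    have := (intervalIntegral.intervalIntegrable_rpow' (a := s - a) (b := 0) hα).comp_sub_left s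
    simpa using this
  rw [restrict_Ioo_eq_restrict_Ioc, ← ofReal_integral_eq_lintegral_ofReal]
  · rw [← intervalIntegral.integral_of_le h,
      intervalIntegral.integral_comp_sub_left (fun r ↦ r ^ α) s, sub_self,
      integral_rpow (Or.inl hα), Real.zero_rpow (by linarith), sub_zero]
  · exact (intervalIntegrable_iff_integrableOn_Ioc_of_le h).1 hi
  · refine (ae_restrict_iff' measurableSet_Ioc).2 (ae_of_all _ fun r hr ↦ ?_)
    exact Real.rpow_nonneg (by linarith [hr.2]) _

lemma lintegral_enorm_sq_eq {f : Torus → ℝ} (hf : Continuous f) :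
    ∫⁻ y, ‖f y‖ₑ ^ 2 = ENNReal.ofReal (∫ y, f y ^ 2) := by
  rw [ofReal_integral_eq_lintegral_ofReal]
  · congr 1
    ext y
    rw [Real.enorm_eq_ofReal_abs, ← ENNReal.ofReal_pow (abs_nonneg _), sq_abs]
  · exact (hf.pow 2).integrable_of_hasCompactSupport (HasCompactSupport.of_compactSpace _)
  · exact ae_of_all _ fun y ↦ sq_nonneg _

lemma one_div_sqrt_sqrt_div_sqrt {r : ℝ} (hr : 0 < r) : 1 / √√r / √r = r ^ (-(3 / 4) : ℝ) := by
  rw [Real.sqrt_eq_rpow, Real.sqrt_eq_rpow, ← Real.rpow_mul hr.le, one_div, ← Real.rpow_neg hr.le,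
    div_eq_mul_inv, ← Real.rpow_neg hr.le, ← Real.rpow_add hr]
  norm_num

/-- Mean-square modulus of continuity of the stochastic convolution kernel, with the scaling of the
heat equation. -/
lemma exists_lintegral_mildKernel_sub_le : ∃ C : ℝ, 0 < C ∧ ∀ s s' : ℝ, 0 ≤ s' → s' ≤ s → s ≤ 1 →
    ∀ (x x' : Torus) (h : ℝ), x - x' = (h : Torus) →
      ∫⁻ z, ‖mildKernel s x z - mildKernel s' x' z‖ₑ ^ 2 ∂spaceTime ≤
        ENNReal.ofReal (C * √(√(s - s') + |h|) * √√s) := by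
  obtain ⟨C, hC, hker⟩ := exists_heatKernel_zero_le
  refine ⟨22 * C, by positivity, fun s s' hs' hss hs1 x x' h hx ↦ ?_⟩
  set δ := s - s' with hδ
  set η := √δ + |h| with hη
  have hδ0 : 0 ≤ δ := by linarith
  have hη0 : 0 ≤ η := by positivity
  -- Before s' both kernels are alive and the increment bound applies. Between s' and s only the
  -- later one is, and its squared norm p_{2(s-r)}(0) ≲ (s - r)^{-1/2} is used.
  let G : ℝ → ℝ≥0∞ := fun r ↦
    (Ioo 0 s').indicator (fun r ↦ ENNReal.ofReal (5 * C * √η) * ENNReal.ofReal ((s' - r) ^ (-(3 / 4) : ℝ))) r +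
    (Ioo s' s).indicator (fun r ↦ ENNReal.ofReal C * ENNReal.ofReal ((s - r) ^ (-(1 / 2) : ℝ))) r
  -- The two open intervals in `G` miss the point s', which is null.
  have hne : ∀ c : ℝ, ∀ᵐ r ∂(volume.restrict (Ioi (0 : ℝ))), r ≠ c := fun c ↦
    ae_restrict_of_ae (by simp [ae_iff])
  have hinner : ∀ᵐ r ∂(volume.restrict (Ioi (0 : ℝ))),
      ∫⁻ y, ‖mildKernel s x (r, y) - mildKernel s' x' (r, y)‖ₑ ^ 2 ≤ G r := by
    filter_upwards [ae_restrict_mem measurableSet_Ioi, hne s'] with r hr hr'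
    have hr0 : 0 < r := hr
    simp only [mildKernel, G]
    rcases lt_or_ge r s' with h1 | h1
    · have h2 : r < s := by linarith
      have h3 : 0 < s' - r := by linarith
      have c1 := continuous_heatKernel (show 0 < s - r by linarith)
      have c2 := continuous_heatKernel h3
      simp only [if_pos h1, if_pos h2]
      rw [lintegral_enorm_sq_eq (by fun_prop), indicator_of_mem (show r ∈ Ioo 0 s' from ⟨hr0, h1⟩)]
      refine le_trans ?_ le_self_add
      rw [← ENNReal.ofReal_mul (by positivity)]
      apply ENNReal.ofReal_le_ofReal
      have e : s - r = (s' - r) + δ := by rw [hδ]; ring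
      rw [e]
      refine (heatKernel_increment_le h3 hδ0 x x' h hx).trans ?_
      rw [← one_div_sqrt_sqrt_div_sqrt h3]
      calc 5 * √η / √√(s' - r) * heatKernel (s' - r) 0
          ≤ 5 * √η / √√(s' - r) * (C / √(s' - r)) := by
            gcongr
            exact hker _ h3 (by linarith)
        _ = _ := by ring
    · rcases lt_or_ge r s with h2 | h2
      · have h3 : 0 < s - r := by linarith
        have c1 := continuous_heatKernel h3
        simp only [if_neg h1.not_gt, if_pos h2, sub_zero]
        rw [lintegral_enorm_sq_eq (by fun_prop),
          indicator_of_mem (show r ∈ Ioo s' s from ⟨lt_of_le_of_ne h1 hr'.symm, h2⟩)]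
        refine le_trans ?_ le_add_self
        rw [← ENNReal.ofReal_mul (by positivity)]
        apply ENNReal.ofReal_le_ofReal
        have e := integral_heatKernel_mul_heatKernel h3 h3 x x
        simp only [sq]
        rw [e, sub_self]
        refine (heatKernel_zero_anti h3 (by linarith)).trans ((hker _ h3 (by linarith)).trans ?_)
        rw [Real.rpow_neg h3.le, Real.sqrt_eq_rpow, div_eq_mul_inv]
      · simp [if_neg h1.not_gt, if_neg h2.not_gt]
  have hmeas : Measurable fun r : ℝ ↦ (Ioo 0 s').indicator (fun r ↦
      ENNReal.ofReal (5 * C * √η) * ENNReal.ofReal ((s' - r) ^ (-(3 / 4) : ℝ))) r :=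
    Measurable.indicator (by fun_prop) measurableSet_Ioo
  have hG : ∫⁻ r, G r ≤ ENNReal.ofReal (22 * C * √η * √√s) := by
    simp only [G]
    rw [lintegral_add_left hmeas, lintegral_indicator measurableSet_Ioo,
      lintegral_indicator measurableSet_Ioo, lintegral_const_mul _ (by fun_prop),
      lintegral_const_mul _ (by fun_prop), lintegral_sub_rpow hs' (by norm_num),
      lintegral_sub_rpow hss (by norm_num), ← ENNReal.ofReal_mul (by positivity),
      ← ENNReal.ofReal_mul (by positivity), ← ENNReal.ofReal_add (by positivity) (by positivity)]
    apply ENNReal.ofReal_le_ofReal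
    have e1 : (s' - 0) ^ (-(3 / 4) + 1 : ℝ) ≤ √√s := by
      rw [sub_zero, Real.sqrt_eq_rpow, Real.sqrt_eq_rpow, ← Real.rpow_mul (by linarith)]
      norm_num
      gcongr
    -- One fourth root of δ is bounded by √η and the other by that of s, so both pieces have the
    -- same form. The constant is 22 = 5·4 + 2, from the integrals of r^{-3/4} and r^{-1/2}.
    have e2 : (s - s') ^ (-(1 / 2) + 1 : ℝ) ≤ √η * √√s := by
      rw [← hδ]
      have : δ ^ (-(1 / 2) + 1 : ℝ) = √√δ * √√δ := by
        rw [Real.mul_self_sqrt (Real.sqrt_nonneg _), Real.sqrt_eq_rpow]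
        norm_num
      rw [this]
      gcongr
      · rw [hη]; linarith [abs_nonneg h]
      · linarith
    have e3 : 0 ≤ √η := Real.sqrt_nonneg _
    calc 5 * C * √η * ((s' - 0) ^ (-(3 / 4) + 1 : ℝ) / (-(3 / 4) + 1)) +
          C * ((s - s') ^ (-(1 / 2) + 1 : ℝ) / (-(1 / 2) + 1))
        = 20 * C * √η * (s' - 0) ^ (-(3 / 4) + 1 : ℝ) +
          2 * C * (s - s') ^ (-(1 / 2) + 1 : ℝ) := by ring
      _ ≤ 20 * C * √η * √√s + 2 * C * (√η * √√s) := by gcongr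
      _ = _ := by ring
  calc _ ≤ ∫⁻ r in Ioi 0, ∫⁻ y, ‖mildKernel s x (r, y) - mildKernel s' x' (r, y)‖ₑ ^ 2 :=
        lintegral_prod_le _
    _ ≤ ∫⁻ r in Ioi 0, G r := lintegral_mono_ae hinner
    _ ≤ ∫⁻ r, G r := setLIntegral_le_lintegral _ _
    _ ≤ _ := hG

end SHE

end

/-! ### Continuity and bounds for the heat semigroup. -/

noncomputable section

namespace SHE

lemma integrable_of_continuous {f : Torus → ℝ} (hf : Continuous f) : Integrable f volume :=
  hf.integrable_of_hasCompactSupport (HasCompactSupport.of_compactSpace _)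

lemma continuousOn_heatSemigroup (f : C(Torus, ℝ)) :
    ContinuousOn (fun q : ℝ × Torus ↦ heatSemigroup q.1 f q.2) (Ioi 0 ×ˢ univ) := by
  intro q hq
  have hq1 : 0 < q.1 := hq.1
  refine ContinuousAt.continuousWithinAt ?_
  have hev : ∀ᶠ p : ℝ × Torus in 𝓝 q, q.1 / 2 < p.1 :=
    (continuous_fst.tendsto q).eventually (lt_mem_nhds (by linarith))
  refine continuousAt_of_dominated (bound := fun _ ↦ heatKernel (q.1 / 2) 0 * ‖f‖) ?_ ?_
    (integrable_const _) ?_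
  · filter_upwards [hev] with p hp
    have := continuous_heatKernel (t := p.1) (by linarith)
    exact Continuous.aestronglyMeasurable (by fun_prop)
  · filter_upwards [hev] with p hp
    refine ae_of_all _ fun y ↦ ?_
    rw [norm_mul, Real.norm_of_nonneg (heatKernel_nonneg _ _)]
    have h1 := (heatKernel_le_zero (t := p.1) (by linarith) (p.2 - y)).trans
      (heatKernel_zero_anti (s := q.1 / 2) (by linarith) hp.le)
    have h2 := f.norm_coe_le_norm y
    exact mul_le_mul h1 h2 (norm_nonneg _) (heatKernel_nonneg _ _)
  · refine ae_of_all _ fun y ↦ ContinuousAt.mul ?_ continuousAt_const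
    have hc := (continuousOn_heatKernel (q.1, q.2 - y) ⟨hq1, mem_univ _⟩).continuousAt
      ((isOpen_Ioi.prod isOpen_univ).mem_nhds ⟨hq1, mem_univ _⟩)
    exact ContinuousAt.comp (f := fun p : ℝ × Torus ↦ (p.1, p.2 - y)) hc (by fun_prop)

lemma heatSemigroup_nonneg {f : C(Torus, ℝ)} (hf : ∀ x, 0 ≤ f x) (t : ℝ) (x : Torus) :
    0 ≤ heatSemigroup t f x :=
  integral_nonneg fun y ↦ mul_nonneg (heatKernel_nonneg _ _) (hf y)

/-- The kernel is a probability density. This bound serves at all intermediate times. -/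
lemma heatSemigroup_le_of_le {f : C(Torus, ℝ)} {c : ℝ} (hf : ∀ x, f x ≤ c) {t : ℝ} (ht : 0 < t)
    (x : Torus) : heatSemigroup t f x ≤ c := by
  have hk := continuous_heatKernel ht
  have h := integral_mono (μ := (volume : Measure Torus))
    (f := fun y ↦ heatKernel t (x - y) * f y) (g := fun y ↦ heatKernel t (x - y) * c)
    (integrable_of_continuous (by fun_prop)) (integrable_of_continuous (by fun_prop))
    (fun y ↦ mul_le_mul_of_nonneg_left (hf y) (heatKernel_nonneg _ _))
  rw [integral_mul_const, integral_heatKernel ht, one_mul] at h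
  exact h

/-- The L¹ to L^∞ smoothing that yields the scale N^{γ/2} at the final time, where the maximum
principle would only give N. -/
lemma heatSemigroup_le_mul_integral {f : C(Torus, ℝ)} (hf : ∀ x, 0 ≤ f x) {t : ℝ} (ht : 0 < t)
    (x : Torus) : heatSemigroup t f x ≤ heatKernel t 0 * ∫ y, f y := by
  have hk := continuous_heatKernel ht
  have h := integral_mono (μ := (volume : Measure Torus))
    (f := fun y ↦ heatKernel t (x - y) * f y) (g := fun y ↦ heatKernel t 0 * f y)
    (integrable_of_continuous (by fun_prop)) (integrable_of_continuous (by fun_prop))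
    (fun y ↦ mul_le_mul_of_nonneg_right (heatKernel_le_zero ht _) (hf y))
  rwa [integral_const_mul] at h

end SHE

end

/-! ### Gaussian calculus for white noise on finitely many sets. -/

noncomputable section

namespace SHE

variable {Ω : Type*} {m : MeasurableSpace Ω} {P : Measure Ω} {F : Filtration ℝ m}
  {W : Set (ℝ × Torus) → Ω → ℝ} {ι : Type*} [Fintype ι]

/-- The covariance form of white noise, evaluated on the step function `∑ i, x i 1_{R i}`. -/
def noiseForm (R : ι → Set (ℝ × Torus)) (x : ι → ℝ) : ℝ :=
  ∑ i, ∑ j, x i * x j * (spaceTime (R i ∩ R j)).toReal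

/-- The stochastic exponential of a simple field, with the step heights `x` frozen. -/
def noiseExp (W : Set (ℝ × Torus) → Ω → ℝ) (R : ι → Set (ℝ × Torus)) (x : ι → Ω → ℝ) (ω : Ω) : ℝ :=
  Real.exp (∑ i, x i ω * W (R i) ω - noiseForm R (fun i ↦ x i ω) / 2)

lemma spaceTime_Ioc_prod_lt_top (a b : ℝ) (A : Set Torus) : spaceTime (Ioc a b ×ˢ A) < ∞ := by
  rw [spaceTime, Measure.prod_prod]
  refine ENNReal.mul_lt_top ((Measure.restrict_apply_le _ _).trans_lt ?_) (measure_lt_top _ _)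
  simp

/-- Identifies the compensator in `noiseExp` with the squared L² norm of the step function, that is,
with the quadratic variation of a simple field. -/
lemma noiseForm_eq_integral {R : ι → Set (ℝ × Torus)} (hR : ∀ i, MeasurableSet (R i))
    (hR' : ∀ i, spaceTime (R i) < ∞) (x : ι → ℝ) :
    ∫⁻ z, ‖∑ i, x i * (R i).indicator 1 z‖ₑ ^ 2 ∂spaceTime = ENNReal.ofReal (noiseForm R x) := by
  have h1 : ∀ z, ‖∑ i, x i * (R i).indicator (1 : ℝ × Torus → ℝ) z‖ₑ ^ 2 =
      ENNReal.ofReal (∑ i, ∑ j, x i * x j * (R i ∩ R j).indicator (1 : ℝ × Torus → ℝ) z) := by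
    intro z
    rw [Real.enorm_eq_ofReal_abs, ← ENNReal.ofReal_pow (abs_nonneg _), sq_abs, sq,
      Finset.sum_mul_sum]
    congr 1
    refine Finset.sum_congr rfl fun i _ ↦ Finset.sum_congr rfl fun j _ ↦ ?_
    rw [inter_indicator_one]
    simp only [Pi.mul_apply]
    ring
  have hi : ∀ i j, Integrable
      (fun z ↦ x i * x j * (R i ∩ R j).indicator (1 : ℝ × Torus → ℝ) z) spaceTime := fun i j ↦ by
    refine Integrable.const_mul ?_ _
    refine (integrable_indicator_iff ((hR i).inter (hR j))).2 ?_
    exact integrableOn_const (((measure_mono inter_subset_left).trans_lt (hR' i)).ne)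
  simp_rw [h1]
  rw [← ofReal_integral_eq_lintegral_ofReal]
  · congr 1
    rw [integral_finsetSum _ fun i _ ↦ integrable_finsetSum _ fun j _ ↦ hi i j]
    unfold noiseForm
    refine Finset.sum_congr rfl fun i _ ↦ ?_
    rw [integral_finsetSum _ fun j _ ↦ hi i j]
    refine Finset.sum_congr rfl fun j _ ↦ ?_
    rw [integral_const_mul, integral_indicator_one ((hR i).inter (hR j))]
    rfl
  · exact integrable_finsetSum _ fun i _ ↦ integrable_finsetSum _ fun j _ ↦ hi i j
  · refine ae_of_all _ fun z ↦ ?_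
    have : ∑ i, ∑ j, x i * x j * (R i ∩ R j).indicator (1 : ℝ × Torus → ℝ) z =
        (∑ i, x i * (R i).indicator (1 : ℝ × Torus → ℝ) z) ^ 2 := by
      rw [sq, Finset.sum_mul_sum]
      refine Finset.sum_congr rfl fun i _ ↦ Finset.sum_congr rfl fun j _ ↦ ?_
      rw [inter_indicator_one]
      simp only [Pi.mul_apply]
      ring
    simp only [Pi.zero_apply, this]
    positivity

namespace IsWhiteNoise

lemma hasGaussianLaw_sum (hW : IsWhiteNoise W F P) {R : ι → Set (ℝ × Torus)}
    (hR : ∀ i, MeasurableSet (R i)) (hR' : ∀ i, spaceTime (R i) < ∞) (x : ι → ℝ) :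
    HasGaussianLaw (fun ω ↦ ∑ i, x i * W (R i) ω) P := by
  classical
  have h := hW.gaussian.comp_right (fun i : ι ↦ ⟨R i, hR i, hR' i⟩)
  have h2 := (h.hasGaussianLaw Finset.univ).map_fun
    (∑ i : ι, x i • (ContinuousLinearMap.proj (R := ℝ) (φ := fun _ : (Finset.univ : Finset ι) ↦ ℝ)
      ⟨i, Finset.mem_univ i⟩))
  convert! h2 using 1
  ext ω
  simp

lemma memLp (hW : IsWhiteNoise W F P) {A : Set (ℝ × Torus)} (hA : MeasurableSet A)
    (hA' : spaceTime A < ∞) : MemLp (W A) 2 P := by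
  simpa using (hW.hasGaussianLaw_sum (ι := Unit) (R := fun _ ↦ A) (fun _ ↦ hA) (fun _ ↦ hA')
    (fun _ ↦ 1)).memLp_two

variable [IsProbabilityMeasure P]

lemma integral_sum (hW : IsWhiteNoise W F P) {R : ι → Set (ℝ × Torus)}
    (hR : ∀ i, MeasurableSet (R i)) (hR' : ∀ i, spaceTime (R i) < ∞) (x : ι → ℝ) :
    ∫ ω, ∑ i, x i * W (R i) ω ∂P = 0 := by
  rw [integral_finsetSum]
  · simp [integral_const_mul, hW.mean _ (hR _) (hR' _)]
  · exact fun i _ ↦ ((hW.memLp (hR i) (hR' i)).integrable (by norm_num)).const_mul _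

lemma variance_sum (hW : IsWhiteNoise W F P) {R : ι → Set (ℝ × Torus)}
    (hR : ∀ i, MeasurableSet (R i)) (hR' : ∀ i, spaceTime (R i) < ∞) (x : ι → ℝ) :
    Var[fun ω ↦ ∑ i, x i * W (R i) ω; P] = noiseForm R x := by
  rw [← covariance_self (hW.hasGaussianLaw_sum hR hR' x).aemeasurable,
    covariance_fun_sum_fun_sum (fun i ↦ (hW.memLp (hR i) (hR' i)).const_mul _)
      (fun i ↦ (hW.memLp (hR i) (hR' i)).const_mul _)]
  unfold noiseForm
  refine Finset.sum_congr rfl fun i _ ↦ Finset.sum_congr rfl fun j _ ↦ ?_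
  rw [covariance_const_mul_left, covariance_const_mul_right,
    hW.covariance _ _ (hR i) (hR' i) (hR j) (hR' j)]
  ring

/-- A centred variable of zero variance vanishes almost surely. Additivity of the noise, which is
not an axiom, follows from this. -/
lemma sum_ae_eq_zero (hW : IsWhiteNoise W F P) {R : ι → Set (ℝ × Torus)}
    (hR : ∀ i, MeasurableSet (R i)) (hR' : ∀ i, spaceTime (R i) < ∞) {x : ι → ℝ}
    (hx : noiseForm R x = 0) : ∀ᵐ ω ∂P, ∑ i, x i * W (R i) ω = 0 := by
  have hL := (hW.hasGaussianLaw_sum hR hR' x).memLp_two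
  have h : eVar[fun ω ↦ ∑ i, x i * W (R i) ω; P] = 0 := by
    rw [← hL.ofReal_variance_eq, hW.variance_sum hR hR', hx, ENNReal.ofReal_zero]
  have h2 := (evariance_eq_zero_iff hL.aestronglyMeasurable.aemeasurable).1 h
  filter_upwards [h2] with ω hω
  rw [hω, hW.integral_sum hR hR']

lemma empty_ae (hW : IsWhiteNoise W F P) : ∀ᵐ ω ∂P, W ∅ ω = 0 := by
  simpa using hW.sum_ae_eq_zero (ι := Unit) (R := fun _ ↦ ∅) (x := fun _ ↦ 1)
    (fun _ ↦ MeasurableSet.empty) (fun _ ↦ by simp) (by simp [noiseForm])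

lemma union_ae (hW : IsWhiteNoise W F P) {A B : Set (ℝ × Torus)} (hA : MeasurableSet A)
    (hA' : spaceTime A < ∞) (hB : MeasurableSet B) (hB' : spaceTime B < ∞) (hAB : Disjoint A B) :
    ∀ᵐ ω ∂P, W (A ∪ B) ω = W A ω + W B ω := by
  have h := hW.sum_ae_eq_zero (ι := Fin 3) (R := ![A ∪ B, A, B]) (x := ![1, -1, -1]) ?_ ?_ ?_
  · filter_upwards [h] with ω hω
    simp [Fin.sum_univ_three] at hω
    linarith
  · intro i
    fin_cases i
    exacts [hA.union hB, hA, hB]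
  · intro i
    fin_cases i
    exacts [(measure_union_le _ _).trans_lt (ENNReal.add_lt_top.2 ⟨hA', hB'⟩), hA', hB']
  · have h1 : spaceTime (A ∪ B) = spaceTime A + spaceTime B := measure_union hAB hB
    have h2 : A ∩ B = ∅ := hAB.inter_eq
    have h3 : B ∩ A = ∅ := by rw [inter_comm, h2]
    simp [noiseForm, Fin.sum_univ_three, h1, h2, h3, ENNReal.toReal_add hA'.ne hB'.ne,
      union_inter_cancel_left, union_inter_cancel_right, inter_union_distrib_left]

lemma lintegral_noiseExp_const (hW : IsWhiteNoise W F P) {R : ι → Set (ℝ × Torus)}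
    (hR : ∀ i, MeasurableSet (R i)) (hR' : ∀ i, spaceTime (R i) < ∞) (x : ι → ℝ) :
    ∫⁻ ω, ENNReal.ofReal (noiseExp W R (fun i _ ↦ x i) ω) ∂P = 1 := by
  set Z := fun ω ↦ ∑ i, x i * W (R i) ω with hZ
  have hL : HasGaussianLaw Z P := hW.hasGaussianLaw_sum hR hR' x
  have h0 : P[Z] = 0 := hW.integral_sum hR hR' x
  have hv : Var[Z; P] = noiseForm R x := hW.variance_sum hR hR' x
  have hv0 : 0 ≤ noiseForm R x := hv ▸ variance_nonneg _ _
  have hmap := hL.map_eq_gaussianReal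
  rw [h0, hv] at hmap
  have hmgf := mgf_gaussianReal hmap 1
  have hint : Integrable (fun ω ↦ Real.exp (Z ω)) P := by
    have := integrable_exp_mul_gaussianReal (μ := 0) (v := (noiseForm R x).toNNReal) 1
    rw [← hmap] at this
    have h2 := this.comp_aemeasurable hL.aemeasurable
    simpa [Function.comp_def] using h2
  have heq : ∀ ω, noiseExp W R (fun i _ ↦ x i) ω =
      Real.exp (-(noiseForm R x / 2)) * Real.exp (Z ω) := fun ω ↦ by
    rw [noiseExp, ← Real.exp_add]
    congr 1
    simp only [hZ]
    ring
  simp_rw [heq]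
  rw [← ofReal_integral_eq_lintegral_ofReal (hint.const_mul _) (ae_of_all _ fun ω ↦ by positivity),
    integral_const_mul]
  have : ∫ ω, Real.exp (Z ω) ∂P = Real.exp (noiseForm R x / 2) := by
    simpa [mgf, Real.coe_toNNReal _ hv0] using hmgf
  rw [this, ← Real.exp_add]
  simp

end IsWhiteNoise

end SHE

end

/-! ### Exponential martingale identity for simple predictable fields. -/

noncomputable section

namespace SHE

variable {Ω : Type*} {m : MeasurableSpace Ω} {P : Measure Ω} {F : Filtration ℝ m}
  {W : Set (ℝ × Torus) → Ω → ℝ} {ι : Type*} [Fintype ι]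

namespace IsWhiteNoise

variable [IsProbabilityMeasure P]

/-- Conditionally on the past, the stochastic exponential over a future region has mean one. -/
lemma lintegral_mul_noiseExp (hW : IsWhiteNoise W F P) {R : ι → Set (ℝ × Torus)}
    (hR : ∀ i, MeasurableSet (R i)) (hR' : ∀ i, spaceTime (R i) < ∞) {T : ℝ} (hT : 0 ≤ T)
    (hRT : ∀ i, R i ⊆ Ioi T ×ˢ univ) {g : Ω → ℝ≥0∞} (hg : Measurable[F T] g) {Y : ι → Ω → ℝ}
    (hY : ∀ i, Measurable[F T] (Y i)) :
    ∫⁻ ω, g ω * ENNReal.ofReal (noiseExp W R Y ω) ∂P = ∫⁻ ω, g ω ∂P := by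
  -- `U` collects the past and `V` the future noise. By independence their joint law is a product,
  -- so the heights can be frozen while integrating over `V`.
  let U : Ω → ℝ≥0∞ × (ι → ℝ) := fun ω ↦ (g ω, fun i ↦ Y i ω)
  let V : Ω → ι → ℝ := fun ω i ↦ W (R i) ω
  have hUF : Measurable[F T] U := hg.prodMk ((@measurable_pi_iff _ _ _ (F T) _ _).2 hY)
  have hU : Measurable U := hUF.mono (F.le T) le_rfl
  have hV : Measurable V := measurable_pi_iff.2 fun i ↦ hW.measurable _ (hR i) (hR' i)
  have hind : IndepFun U V P := by
    rw [IndepFun_iff_Indep]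
    refine indep_of_indep_of_le_left (indep_of_indep_of_le_right (hW.indep T hT) ?_) hUF.comap_le
    rw [← measurable_iff_comap_le]
    refine @measurable_pi_iff _ _ _ (_) _ _ |>.2 fun i ↦ ?_
    rw [measurable_iff_comap_le]
    exact le_iSup₂_of_le (R i) ⟨hR i, hR' i, hRT i⟩ le_rfl
  have hprod := (indepFun_iff_map_prod_eq_prod_map_map hU.aemeasurable hV.aemeasurable).1 hind
  let h : (ℝ≥0∞ × (ι → ℝ)) × (ι → ℝ) → ℝ≥0∞ := fun p ↦
    p.1.1 * ENNReal.ofReal (Real.exp (∑ i, p.1.2 i * p.2 i - noiseForm R p.1.2 / 2))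
  have hh : Measurable h := by
    unfold h noiseForm
    fun_prop
  have hP1 : IsProbabilityMeasure (P.map U) := Measure.isProbabilityMeasure_map hU.aemeasurable
  have hP2 : IsProbabilityMeasure (P.map V) := Measure.isProbabilityMeasure_map hV.aemeasurable
  calc ∫⁻ ω, g ω * ENNReal.ofReal (noiseExp W R Y ω) ∂P
      = ∫⁻ ω, h (U ω, V ω) ∂P := rfl
    _ = ∫⁻ p, h p ∂(P.map fun ω ↦ (U ω, V ω)) := (lintegral_map hh (hU.prodMk hV)).symm
    _ = ∫⁻ u, ∫⁻ v, h (u, v) ∂(P.map V) ∂(P.map U) := by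
        rw [hprod, lintegral_prod _ hh.aemeasurable]
    _ = ∫⁻ u, u.1 ∂(P.map U) := by
        congr 1
        ext u
        rw [lintegral_map (f := fun v ↦ h (u, v)) (hh.comp measurable_prodMk_left) hV]
        simp only [h]
        rw [lintegral_const_mul]
        · have := hW.lintegral_noiseExp_const hR hR' u.2
          unfold noiseExp at this
          rw [this, mul_one]
        · have h3 := fun i ↦ measurable_pi_iff.1 hV i
          simp only [V] at h3 ⊢
          fun_prop
    _ = ∫⁻ ω, g ω ∂P := lintegral_map measurable_fst hU

lemma noiseExp_congr_ae (hW : IsWhiteNoise W F P) {R : ι → Set (ℝ × Torus)} {X Y : ι → Ω → ℝ}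
    (h : ∀ i, R i = ∅ ∨ Y i = X i) : noiseExp W R X =ᵐ[P] noiseExp W R Y := by
  filter_upwards [hW.empty_ae] with ω hω
  have h1 : ∑ i, X i ω * W (R i) ω = ∑ i, Y i ω * W (R i) ω := by
    refine Finset.sum_congr rfl fun i _ ↦ ?_
    rcases h i with h | h
    · simp [h, hω]
    · rw [h]
  have h2 : noiseForm R (fun i ↦ X i ω) = noiseForm R (fun i ↦ Y i ω) := by
    refine Finset.sum_congr rfl fun i _ ↦ Finset.sum_congr rfl fun j _ ↦ ?_
    rcases h i with h1 | h1
    · simp [h1]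
    · rcases h j with h2 | h2
      · simp [h2]
      · simp only [h1, h2]
  rw [noiseExp, noiseExp, h1, h2]

/-- The noise is additive, and pieces inside and outside `B` are disjoint, so the quadratic form has
no cross terms. -/
lemma noiseExp_split_ae (hW : IsWhiteNoise W F P) {R : ι → Set (ℝ × Torus)}
    (hR : ∀ i, MeasurableSet (R i)) (hR' : ∀ i, spaceTime (R i) < ∞) {B : Set (ℝ × Torus)}
    (hB : MeasurableSet B) (X : ι → Ω → ℝ) :
    noiseExp W R X =ᵐ[P]
      fun ω ↦ noiseExp W (fun i ↦ R i ∩ B) X ω * noiseExp W (fun i ↦ R i \ B) X ω := by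
  have h1 : ∀ᵐ ω ∂P, ∀ i, W (R i) ω = W (R i ∩ B) ω + W (R i \ B) ω := by
    refine ae_all_iff.2 fun i ↦ ?_
    have := hW.union_ae ((hR i).inter hB) ((measure_mono inter_subset_left).trans_lt (hR' i))
      ((hR i).diff hB) ((measure_mono sdiff_subset).trans_lt (hR' i)) disjoint_sdiff_inter.symm
    rwa [inter_union_sdiff] at this
  have h2 : ∀ i j, (spaceTime (R i ∩ R j)).toReal =
      (spaceTime (R i ∩ B ∩ (R j ∩ B))).toReal + (spaceTime (R i \ B ∩ (R j \ B))).toReal := by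
    intro i j
    rw [← measure_inter_add_sdiff (R i ∩ R j) hB, ENNReal.toReal_add]
    · congr 3 <;> ext z <;> simp <;> tauto
    · exact ((measure_mono (inter_subset_left.trans inter_subset_left)).trans_lt (hR' i)).ne
    · exact ((measure_mono (sdiff_subset.trans inter_subset_left)).trans_lt (hR' i)).ne
  filter_upwards [h1] with ω hω
  unfold noiseExp noiseForm
  rw [← Real.exp_add]
  congr 1
  simp_rw [h2, hω, mul_add, Finset.sum_add_distrib]
  ring

/-- The stochastic exponential of a simple predictable field has mean one. -/
lemma lintegral_noiseExp (hW : IsWhiteNoise W F P) (S : Finset ℝ) :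
    ∀ (a b : ι → ℝ) (A : ι → Set Torus) (X : ι → Ω → ℝ), (∀ s ∈ S, 0 ≤ s) →
      (∀ i, a i ≤ b i) → (∀ i, a i ∈ S) → (∀ i, b i ∈ S) → (∀ i, MeasurableSet (A i)) →
      (∀ i, Measurable[F (a i)] (X i)) →
      ∫⁻ ω, ENNReal.ofReal (noiseExp W (fun i ↦ Ioc (a i) (b i) ×ˢ A i) X ω) ∂P = 1 := by
  classical
  -- Induction on the set of time endpoints: the largest one `T'` is removed by integrating out the
  -- noise after the previous one `T`, conditionally on the past up to `T`.
  refine Finset.induction_on_max S ?_ ?_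
  · intro a b A X _ _ ha _ _ _
    have : IsEmpty ι := ⟨fun i ↦ by simpa using ha i⟩
    simp [noiseExp, noiseForm]
  · intro T' S hmax ih a b A X hS hab ha hb hA hX
    rcases S.eq_empty_or_nonempty with rfl | hne
    · have hR : ∀ i, Ioc (a i) (b i) ×ˢ A i = ∅ := fun i ↦ by
        have h1 := ha i
        have h2 := hb i
        simp only [insert_empty_eq, Finset.mem_singleton] at h1 h2
        simp [h1, h2]
      have h := hW.noiseExp_congr_ae (X := X) (Y := fun _ _ ↦ 0) (fun i ↦ Or.inl (hR i))
      rw [lintegral_congr_ae (h.mono fun ω hω ↦ by rw [hω])]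
      simp [noiseExp, noiseForm]
    · set T := S.max' hne with hTdef
      have hTS : T ∈ S := S.max'_mem hne
      have hle : ∀ s ∈ S, s ≤ T := fun s hs ↦ S.le_max' s hs
      have hT0 : 0 ≤ T := hS T (Finset.mem_insert_of_mem hTS)
      have hTT : T < T' := hmax T hTS
      let R : ι → Set (ℝ × Torus) := fun i ↦ Ioc (a i) (b i) ×ˢ A i
      let B : Set (ℝ × Torus) := Iic T ×ˢ univ
      have hB : MeasurableSet B := measurableSet_Iic.prod MeasurableSet.univ
      have hR : ∀ i, MeasurableSet (R i) := fun i ↦ measurableSet_Ioc.prod (hA i)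
      have hR' : ∀ i, spaceTime (R i) < ∞ := fun i ↦ spaceTime_Ioc_prod_lt_top _ _ _
      -- A height starting at `T'` need not be measurable at time `T`, but its rectangle is empty,
      -- since no right endpoint exceeds `T'`. Replacing it by 0 changes nothing almost surely.
      let Y : ι → Ω → ℝ := fun i ↦ if a i ≤ T then X i else 0
      have hcase : ∀ i, a i ∈ S ∨ a i = T' := fun i ↦ (Finset.mem_insert.1 (ha i)).symm
      have hbT : ∀ i, b i ≤ T' := fun i ↦ by
        rcases Finset.mem_insert.1 (hb i) with h | h
        · exact h.le
        · exact (hmax _ h).le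
      have hXY : ∀ i, R i = ∅ ∨ Y i = X i := fun i ↦ by
        rcases hcase i with h | h
        · right
          simp [Y, hle _ h]
        · left
          have : ¬ a i < b i := by rw [h]; exact (hbT i).not_gt
          simp [R, this]
      have hRB : ∀ i, R i ∩ B = Ioc (min (a i) T) (min (b i) T) ×ˢ A i := fun i ↦ by
        ext ⟨r, y⟩
        simp only [R, B, mem_inter_iff, mem_prod, mem_Ioc, mem_Iic, mem_univ, and_true,
          le_min_iff, min_lt_iff]
        constructor
        · tauto
        · rintro ⟨⟨h1 | h1, h2, h3⟩, h4⟩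
          · tauto
          · exact absurd h1 h3.not_gt
      have hminS : ∀ c ∈ insert T' S, min c T ∈ S := fun c hc ↦ by
        rcases Finset.mem_insert.1 hc with h | h
        · rw [h, min_eq_right hTT.le]; exact hTS
        · rwa [min_eq_left (hle _ h)]
      have hYa : ∀ i, Measurable[F (min (a i) T)] (Y i) := fun i ↦ by
        by_cases h : a i ≤ T
        · simp only [Y, if_pos h]
          exact (hX i).mono (F.mono (le_min le_rfl h)) le_rfl
        · simp only [Y, if_neg h]
          exact measurable_const
      have hYT : ∀ i, Measurable[F T] (Y i) := fun i ↦
        (hYa i).mono (F.mono (min_le_right _ _)) le_rfl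
      have hih := ih (fun i ↦ min (a i) T) (fun i ↦ min (b i) T) A Y
        (fun s hs ↦ hS s (Finset.mem_insert_of_mem hs)) (fun i ↦ min_le_min_right _ (hab i))
        (fun i ↦ hminS _ (ha i)) (fun i ↦ hminS _ (hb i)) hA hYa
      have hg : Measurable[F T] fun ω ↦
          ENNReal.ofReal (noiseExp W (fun i ↦ R i ∩ B) Y ω) := by
        have hw : ∀ i, Measurable[F T] (W (R i ∩ B)) := fun i ↦ by
          refine hW.adapted T hT0 _ ((hR i).inter hB) ?_
          rw [hRB]
          refine prod_mono (fun r hr ↦ ⟨?_, hr.2.trans (min_le_right _ _)⟩) (subset_univ _)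
          exact (hS _ (Finset.mem_insert_of_mem (hminS _ (ha i)))).trans_lt hr.1
        unfold noiseExp noiseForm
        refine Measurable.ennreal_ofReal (Real.measurable_exp.comp ?_)
        refine Measurable.sub ?_ (Measurable.div_const ?_ _)
        · exact Finset.measurable_fun_sum _ fun i _ ↦ (hYT i).mul (hw i)
        · exact Finset.measurable_fun_sum _ fun i _ ↦ Finset.measurable_fun_sum _ fun j _ ↦
            ((hYT i).mul (hYT j)).mul measurable_const
      have h1 := (hW.noiseExp_congr_ae hXY).trans (hW.noiseExp_split_ae hR hR' hB Y)
      rw [lintegral_congr_ae (h1.mono fun ω hω ↦ by rw [hω])]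
      have h2 : ∀ ω, ENNReal.ofReal (noiseExp W (fun i ↦ R i ∩ B) Y ω *
          noiseExp W (fun i ↦ R i \ B) Y ω) =
          ENNReal.ofReal (noiseExp W (fun i ↦ R i ∩ B) Y ω) *
          ENNReal.ofReal (noiseExp W (fun i ↦ R i \ B) Y ω) := fun ω ↦
        ENNReal.ofReal_mul (Real.exp_pos _).le
      simp_rw [h2]
      rw [hW.lintegral_mul_noiseExp (T := T) (fun i ↦ (hR i).diff hB)
        (fun i ↦ (measure_mono sdiff_subset).trans_lt (hR' i)) hT0 ?_ hg hYT]
      · simp_rw [hRB]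
        exact hih
      · rintro i ⟨r, y⟩ ⟨-, h⟩
        simpa [B] using h

end IsWhiteNoise

/-- The exponential martingale identity for simple predictable fields. -/
lemma Simple.lintegral_exp [IsProbabilityMeasure P] (hW : IsWhiteNoise W F P) (Φ : Simple F)
    (c : ℝ) :
    ∫⁻ ω, ENNReal.ofReal (Real.exp (c * Φ.integral W ω -
      c ^ 2 * (∫⁻ z, ‖Φ.toField (ω, z)‖ₑ ^ 2 ∂spaceTime).toReal / 2)) ∂P = 1 := by
  classical
  let e : Fin Φ.length → Elementary F := fun i ↦ Φ[i]
  have h := hW.lintegral_noiseExp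
    (Finset.univ.image (fun i ↦ (e i).a) ∪ Finset.univ.image (fun i ↦ (e i).b))
    (fun i ↦ (e i).a) (fun i ↦ (e i).b) (fun i ↦ (e i).A) (fun i ω ↦ c * (e i).X ω)
    (by
      intro s hs
      simp only [Finset.mem_union, Finset.mem_image, Finset.mem_univ, true_and] at hs
      rcases hs with ⟨i, rfl⟩ | ⟨i, rfl⟩
      · exact (e i).a_nonneg
      · exact (e i).a_nonneg.trans (e i).a_le_b)
    (fun i ↦ (e i).a_le_b) (fun i ↦ by simp) (fun i ↦ by simp)
    (fun i ↦ (e i).measurableSet_A) (fun i ↦ (e i).measurable_X.const_mul c)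
  rw [← h]
  congr 1
  ext ω
  have hint : Φ.integral W ω = ∑ i, (e i).X ω * W (Ioc (e i).a (e i).b ×ˢ (e i).A) ω :=
    (Fin.sum_univ_fun_getElem Φ (fun e ↦ e.integral W ω)).symm
  have hfield : ∀ z, Φ.toField (ω, z) =
      ∑ i, (e i).X ω * (Ioc (e i).a (e i).b ×ˢ (e i).A).indicator 1 z := fun z ↦
    (Fin.sum_univ_fun_getElem Φ (fun e ↦ e.toField (ω, z))).symm
  have hq0 : ∀ x : Fin Φ.length → ℝ,
      0 ≤ noiseForm (fun i ↦ Ioc (e i).a (e i).b ×ˢ (e i).A) x := fun x ↦ by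
    rw [← hW.variance_sum (fun i ↦ measurableSet_Ioc.prod (e i).measurableSet_A)
      (fun i ↦ spaceTime_Ioc_prod_lt_top _ _ _)]
    exact variance_nonneg _ _
  simp_rw [hfield]
  rw [noiseForm_eq_integral (fun i ↦ measurableSet_Ioc.prod (e i).measurableSet_A)
      (fun i ↦ spaceTime_Ioc_prod_lt_top _ _ _), ENNReal.toReal_ofReal (hq0 _), hint, noiseExp]
  congr 3
  · rw [Finset.mul_sum]
    exact Finset.sum_congr rfl fun i _ ↦ by ring
  · unfold noiseForm
    rw [Finset.mul_sum]
    refine congrArg (· / 2) (Finset.sum_congr rfl fun i _ ↦ ?_)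
    rw [Finset.mul_sum]
    exact Finset.sum_congr rfl fun j _ ↦ by ring

end SHE

end

/-! ### Approximation of Walsh integrals and their Gaussian tail. -/

noncomputable section

namespace SHE

/-- A sequence of functions whose integrals tend to zero has a subsequence tending to zero a.e. -/
lemma exists_subseq_tendsto_zero_of_lintegral {α : Type*} {mα : MeasurableSpace α} {μ : Measure α}
    {f : ℕ → α → ℝ≥0∞} (hf : ∀ n, AEMeasurable (f n) μ)
    (h : Tendsto (fun n ↦ ∫⁻ x, f n x ∂μ) atTop (𝓝 0)) :
    ∃ φ : ℕ → ℕ, StrictMono φ ∧ ∀ᵐ x ∂μ, Tendsto (fun k ↦ f (φ k) x) atTop (𝓝 0) := by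
  have hev : ∀ k : ℕ, ∀ᶠ n in atTop, ∫⁻ x, f n x ∂μ ≤ (1 / 2 : ℝ≥0∞) ^ k := fun k ↦
    h.eventually_le_const (ENNReal.pow_pos (by simp) k)
  obtain ⟨φ, hφ, hφ'⟩ := extraction_forall_of_eventually hev
  refine ⟨φ, hφ, ?_⟩
  have hsum : ∫⁻ x, ∑' k, f (φ k) x ∂μ ≠ ∞ := by
    rw [lintegral_tsum fun k ↦ hf _]
    refine ((ENNReal.tsum_le_tsum hφ').trans_lt ?_).ne
    rw [ENNReal.tsum_geometric]
    simp
  filter_upwards [ae_lt_top' (AEMeasurable.tsum fun k ↦ hf (φ k)) hsum] with x hx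
  exact ENNReal.tendsto_atTop_zero_of_tsum_ne_top hx.ne

lemma eLpNorm_two_sq {α : Type*} {mα : MeasurableSpace α} (f : α → ℝ) (μ : Measure α) :
    eLpNorm f 2 μ ^ 2 = ∫⁻ x, ‖f x‖ₑ ^ 2 ∂μ := by
  simpa using eLpNorm_nnreal_pow_eq_lintegral (f := f) (μ := μ) (p := 2) (by norm_num)

lemma list_sum_map_neg {α : Type*} (f : α → ℝ) (l : List α) :
    (l.map fun x ↦ -f x).sum = -(l.map f).sum := by
  induction l with
  | nil => simp
  | cons x l ih => simp [ih, add_comm]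

variable {Ω : Type*} {m : MeasurableSpace Ω} {P : Measure Ω} {F : Filtration ℝ m}
  {W : Set (ℝ × Torus) → Ω → ℝ}

instance : SFinite spaceTime := by unfold spaceTime; infer_instance

lemma Elementary.measurable_toField (e : Elementary F) : Measurable e.toField := by
  unfold Elementary.toField
  refine Measurable.mul ((e.measurable_X.mono (F.le _) le_rfl).comp measurable_fst) ?_
  exact (measurable_one.indicator (measurableSet_Ioc.prod e.measurableSet_A)).comp measurable_snd

lemma Simple.measurable_toField (Φ : Simple F) : Measurable Φ.toField := by
  unfold Simple.toField
  induction Φ with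
  | nil => simp
  | cons e Φ ih => simpa using e.measurable_toField.fun_add ih

lemma Simple.measurable_integral (hW : IsWhiteNoise W F P) (Φ : Simple F) :
    Measurable (Φ.integral W) := by
  unfold Simple.integral
  induction Φ with
  | nil => simp
  | cons e Φ ih =>
    have : Measurable (e.integral W) := by
      unfold Elementary.integral
      exact (e.measurable_X.mono (F.le _) le_rfl).mul
        (hW.measurable _ (measurableSet_Ioc.prod e.measurableSet_A)
          (spaceTime_Ioc_prod_lt_top _ _ _))
    simpa using this.fun_add ih

/-- The negative of an elementary field. -/
def Elementary.neg (e : Elementary F) : Elementary F where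
  a := e.a
  b := e.b
  a_nonneg := e.a_nonneg
  a_le_b := e.a_le_b
  A := e.A
  measurableSet_A := e.measurableSet_A
  X := fun ω ↦ -e.X ω
  measurable_X := e.measurable_X.neg
  bounded_X := by simpa using e.bounded_X

lemma Simple.toField_append_neg (Φ Ψ : Simple F) (z : Ω × (ℝ × Torus)) :
    Simple.toField (Φ ++ Ψ.map Elementary.neg) z = Φ.toField z - Ψ.toField z := by
  have : (fun e : Elementary F ↦ e.neg.toField z) = fun e ↦ -e.toField z := by
    ext e
    simp [Elementary.toField, Elementary.neg]
  simp [Simple.toField, Function.comp_def, this, list_sum_map_neg, sub_eq_add_neg]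

lemma Simple.integral_append_neg (Φ Ψ : Simple F) (ω : Ω) :
    Simple.integral W (Φ ++ Ψ.map Elementary.neg) ω = Φ.integral W ω - Ψ.integral W ω := by
  have : (fun e : Elementary F ↦ e.neg.integral W ω) = fun e ↦ -e.integral W ω := by
    ext e
    simp [Elementary.integral, Elementary.neg]
  simp [Simple.integral, Function.comp_def, this, list_sum_map_neg, sub_eq_add_neg]

namespace IsWalshIntegral

lemma zero : IsWalshIntegral W F P 0 0 where
  memLp_field := MemLp.zero
  memLp_integral := MemLp.zero
  approx := ⟨fun _ ↦ [], by simp [Simple.toField], by simp [Simple.integral]⟩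

lemma congr {h h' : Ω × (ℝ × Torus) → ℝ} {I : Ω → ℝ} (hI : IsWalshIntegral W F P h I)
    (hh : h =ᵐ[P.prod spaceTime] h') : IsWalshIntegral W F P h' I where
  memLp_field := (memLp_congr_ae hh).1 hI.memLp_field
  memLp_integral := hI.memLp_integral
  approx := by
    obtain ⟨Φ, h1, h2⟩ := hI.approx
    refine ⟨Φ, ?_, h2⟩
    refine h1.congr fun n ↦ eLpNorm_congr_ae ?_
    filter_upwards [hh] with z hz
    rw [hz]

/-- Makes increments of the stochastic convolution between two space-time points Walsh integrals
themselves. -/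
lemma sub (hW : IsWhiteNoise W F P) {h h' : Ω × (ℝ × Torus) → ℝ} {I I' : Ω → ℝ}
    (hI : IsWalshIntegral W F P h I) (hI' : IsWalshIntegral W F P h' I') :
    IsWalshIntegral W F P (fun z ↦ h z - h' z) (fun ω ↦ I ω - I' ω) where
  memLp_field := hI.memLp_field.sub hI'.memLp_field
  memLp_integral := hI.memLp_integral.sub hI'.memLp_integral
  approx := by
    obtain ⟨Φ, h1, h2⟩ := hI.approx
    obtain ⟨Ψ, h3, h4⟩ := hI'.approx
    refine ⟨fun n ↦ Φ n ++ (Ψ n).map Elementary.neg, ?_, ?_⟩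
    · have hlim := h1.add h3
      rw [add_zero] at hlim
      refine tendsto_of_tendsto_of_tendsto_of_le_of_le tendsto_const_nhds hlim
        (fun n ↦ zero_le) (fun n ↦ ?_)
      refine le_trans (le_of_eq ?_) (eLpNorm_sub_le
        ((Φ n).measurable_toField.aestronglyMeasurable.sub hI.memLp_field.1)
        ((Ψ n).measurable_toField.aestronglyMeasurable.sub hI'.memLp_field.1) (by norm_num))
      congr 1
      ext z
      simp only [Simple.toField_append_neg, Pi.sub_apply]
      ring
    · have hlim := h2.add h4
      rw [add_zero] at hlim
      refine tendsto_of_tendsto_of_tendsto_of_le_of_le tendsto_const_nhds hlim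
        (fun n ↦ zero_le) (fun n ↦ ?_)
      refine le_trans (le_of_eq ?_) (eLpNorm_sub_le
        (((Φ n).measurable_integral hW).aestronglyMeasurable.sub hI.memLp_integral.1)
        (((Ψ n).measurable_integral hW).aestronglyMeasurable.sub hI'.memLp_integral.1)
        (by norm_num))
      congr 1
      ext ω
      simp only [Simple.integral_append_neg, Pi.sub_apply]
      ring

/-- Along a subsequence of an approximating sequence, the integrals converge almost surely and the
fields converge in `L²` of space-time almost surely. -/
lemma exists_approx_ae (hW : IsWhiteNoise W F P) {h : Ω × (ℝ × Torus) → ℝ} {I : Ω → ℝ}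
    (hI : IsWalshIntegral W F P h I) : ∃ Φ : ℕ → Simple F, ∀ᵐ ω ∂P,
      Tendsto (fun n ↦ eLpNorm (fun z ↦ (Φ n).toField (ω, z) - h (ω, z)) 2 spaceTime) atTop (𝓝 0) ∧
      Tendsto (fun n ↦ (Φ n).integral W ω) atTop (𝓝 (I ω)) := by
  obtain ⟨Φ, h1, h2⟩ := hI.approx
  have hm : ∀ n, AEMeasurable (fun z ↦ ‖(Φ n).toField z - h z‖ₑ ^ 2) (P.prod spaceTime) := fun n ↦
    ((Φ n).measurable_toField.aestronglyMeasurable.sub hI.memLp_field.1).enorm.pow_const 2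
  have hm2 : ∀ n, AEMeasurable (fun ω ↦ ‖(Φ n).integral W ω - I ω‖ₑ ^ 2) P := fun n ↦
    (((Φ n).measurable_integral hW).aestronglyMeasurable.sub hI.memLp_integral.1).enorm.pow_const 2
  have hm1 : ∀ n, AEMeasurable
      (fun ω ↦ ∫⁻ z, ‖(Φ n).toField (ω, z) - h (ω, z)‖ₑ ^ 2 ∂spaceTime) P := fun n ↦
    (hm n).lintegral_prod_right'
  -- Adding the two errors lets a single subsequence serve both convergences.
  have hlim : Tendsto (fun n ↦ ∫⁻ ω, (∫⁻ z, ‖(Φ n).toField (ω, z) - h (ω, z)‖ₑ ^ 2 ∂spaceTime) +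
      ‖(Φ n).integral W ω - I ω‖ₑ ^ 2 ∂P) atTop (𝓝 0) := by
    have h3 := ((ENNReal.continuous_pow 2).tendsto 0).comp h1
    have h4 := ((ENNReal.continuous_pow 2).tendsto 0).comp h2
    have h5 := h3.add h4
    simp only [Function.comp_def, eLpNorm_two_sq, ne_eq, OfNat.ofNat_ne_zero, not_false_eq_true,
      zero_pow, add_zero] at h5
    refine h5.congr fun n ↦ ?_
    rw [lintegral_add_left' (hm1 n), lintegral_prod _ (hm n)]
  obtain ⟨φ, -, hφ⟩ := exists_subseq_tendsto_zero_of_lintegral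
    (fun n ↦ (hm1 n).add (hm2 n)) hlim
  refine ⟨fun n ↦ Φ (φ n), ?_⟩
  have hsqrt : ∀ {f : ℕ → ℝ≥0∞}, Tendsto (fun n ↦ f n ^ 2) atTop (𝓝 0) →
      Tendsto f atTop (𝓝 0) := fun {f} hf ↦ by
    have := ((ENNReal.continuous_rpow_const (y := 1 / 2)).tendsto 0).comp hf
    rw [ENNReal.zero_rpow_of_pos (by norm_num)] at this
    refine this.congr fun n ↦ ?_
    simp only [Function.comp_apply]
    rw [← ENNReal.rpow_natCast, ← ENNReal.rpow_mul]
    norm_num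
  filter_upwards [hφ] with ω hω
  constructor
  · refine hsqrt ?_
    simp only [eLpNorm_two_sq]
    exact tendsto_of_tendsto_of_tendsto_of_le_of_le tendsto_const_nhds hω
      (fun n ↦ zero_le) (fun n ↦ le_self_add)
  · rw [tendsto_iff_edist_tendsto_0]
    simp only [edist_eq_enorm_sub]
    refine hsqrt ?_
    exact tendsto_of_tendsto_of_tendsto_of_le_of_le tendsto_const_nhds hω
      (fun n ↦ zero_le) (fun n ↦ le_add_self)

variable [IsProbabilityMeasure P]

/-- Chernoff's bound for the exponential martingale. Its mean is exactly one for simple fields, and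
Fatou's lemma keeps it at most one in the limit, with no exponential moment assumed of `I`. -/
lemma measure_ge_le (hW : IsWhiteNoise W F P) {h : Ω × (ℝ × Torus) → ℝ} {I : Ω → ℝ}
    (hI : IsWalshIntegral W F P h I) {a b : ℝ} (ha : 0 ≤ a) (hb : 0 < b) :
    P {ω | a ≤ I ω ∧ ∫⁻ z, ‖h (ω, z)‖ₑ ^ 2 ∂spaceTime ≤ ENNReal.ofReal b} ≤
      ENNReal.ofReal (Real.exp (-(a ^ 2 / (2 * b)))) := by
  obtain ⟨Φ, hΦ⟩ := hI.exists_approx_ae hW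
  -- The maximiser of ca - c²b/2, with maximum a²/(2b).
  set c := a / b with hc
  have hc0 : 0 ≤ c := by positivity
  let q : ℕ → Ω → ℝ := fun n ω ↦ (∫⁻ z, ‖(Φ n).toField (ω, z)‖ₑ ^ 2 ∂spaceTime).toReal
  let g : ℕ → Ω → ℝ≥0∞ := fun n ω ↦
    ENNReal.ofReal (Real.exp (c * (Φ n).integral W ω - c ^ 2 * q n ω / 2))
  have hgm : ∀ n, Measurable (g n) := fun n ↦ by
    have h1 := (Φ n).measurable_integral hW
    have h2 : Measurable (q n) :=
      (((Φ n).measurable_toField.enorm.pow_const 2).lintegral_prod_right').ennreal_toReal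
    unfold g
    fun_prop
  have hg1 : ∀ n, ∫⁻ ω, g n ω ∂P = 1 := fun n ↦ (Φ n).lintegral_exp hW c
  have hlim : ∫⁻ ω, liminf (fun n ↦ g n ω) atTop ∂P ≤ 1 := by
    refine (lintegral_liminf_le hgm).trans ?_
    simp [hg1]
  have hsm : ∀ᵐ ω ∂P, AEStronglyMeasurable (fun z ↦ h (ω, z)) spaceTime :=
    hI.memLp_field.1.prodMk_left
  -- By Minkowski the quadratic variation of the n-th simple field is at most (H + d n)², which
  -- tends to H² ≤ b. On the event, this bounds the limiting exponent from below.
  have hsub : ∀ᵐ ω ∂P, (a ≤ I ω ∧ ∫⁻ z, ‖h (ω, z)‖ₑ ^ 2 ∂spaceTime ≤ ENNReal.ofReal b) →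
      ENNReal.ofReal (Real.exp (a ^ 2 / (2 * b))) ≤ liminf (fun n ↦ g n ω) atTop := by
    filter_upwards [hΦ, hsm] with ω hω hmω ⟨hω1, hω2⟩
    set H := eLpNorm (fun z ↦ h (ω, z)) 2 spaceTime with hH
    set d : ℕ → ℝ≥0∞ := fun n ↦ eLpNorm (fun z ↦ (Φ n).toField (ω, z) - h (ω, z)) 2 spaceTime
    have hHsq : H ^ 2 ≤ ENNReal.ofReal b := by rw [hH, eLpNorm_two_sq]; exact hω2
    have hHfin : H ≠ ∞ := fun h ↦ by simp [h] at hHsq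
    have hdlim : Tendsto (fun n ↦ (H + d n) ^ 2) atTop (𝓝 (H ^ 2)) := by
      have h1 : Tendsto (fun n ↦ H + d n) atTop (𝓝 (H + 0)) := tendsto_const_nhds.add hω.1
      rw [add_zero] at h1
      exact ((ENNReal.continuous_pow 2).tendsto _).comp h1
    have hdreal := (ENNReal.tendsto_toReal (ENNReal.pow_ne_top hHfin)).comp hdlim
    have hlow : Tendsto (fun n ↦ ENNReal.ofReal (Real.exp (c * (Φ n).integral W ω -
        c ^ 2 * ((H + d n) ^ 2).toReal / 2))) atTop
        (𝓝 (ENNReal.ofReal (Real.exp (c * I ω - c ^ 2 * (H ^ 2).toReal / 2)))) := by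
      refine ENNReal.tendsto_ofReal ((Real.continuous_exp.tendsto _).comp ?_)
      exact (hω.2.const_mul c).sub ((hdreal.const_mul _).div_const 2)
    have hdfin : ∀ᶠ n in atTop, d n < ∞ := hω.1.eventually_lt_const (by simp)
    have hle : ∀ᶠ n in atTop, ENNReal.ofReal (Real.exp (c * (Φ n).integral W ω -
        c ^ 2 * ((H + d n) ^ 2).toReal / 2)) ≤ g n ω := by
      filter_upwards [hdfin] with n hn
      apply ENNReal.ofReal_le_ofReal
      apply Real.exp_le_exp.2
      have h1 : eLpNorm (fun z ↦ (Φ n).toField (ω, z)) 2 spaceTime ≤ H + d n := by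
        have hΦm : AEStronglyMeasurable (fun z ↦ (Φ n).toField (ω, z)) spaceTime :=
          ((Φ n).measurable_toField.comp measurable_prodMk_left).aestronglyMeasurable
        refine le_trans (le_of_eq ?_) (eLpNorm_add_le hmω (hΦm.sub hmω) (by norm_num))
        congr 1
        ext z
        simp
      have h2 : q n ω ≤ ((H + d n) ^ 2).toReal := by
        refine ENNReal.toReal_mono (ENNReal.pow_ne_top (ENNReal.add_ne_top.2 ⟨hHfin, hn.ne⟩)) ?_
        rw [← eLpNorm_two_sq]
        gcongr
      have := mul_le_mul_of_nonneg_left h2 (sq_nonneg c)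
      linarith
    have hfin : Real.exp (a ^ 2 / (2 * b)) ≤ Real.exp (c * I ω - c ^ 2 * (H ^ 2).toReal / 2) := by
      apply Real.exp_le_exp.2
      have h1 : (H ^ 2).toReal ≤ b := ENNReal.toReal_le_of_le_ofReal hb.le hHsq
      have h2 : a ^ 2 / (2 * b) = c * a - c ^ 2 * b / 2 := by
        rw [hc]
        field_simp
        ring
      rw [h2]
      have h3 := mul_le_mul_of_nonneg_left hω1 hc0
      have h4 := mul_le_mul_of_nonneg_left h1 (sq_nonneg c)
      linarith
    calc _ ≤ ENNReal.ofReal (Real.exp (c * I ω - c ^ 2 * (H ^ 2).toReal / 2)) :=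
          ENNReal.ofReal_le_ofReal hfin
      _ = _ := hlow.liminf_eq.symm
      _ ≤ _ := liminf_le_liminf hle
  have hpos : 0 < Real.exp (a ^ 2 / (2 * b)) := Real.exp_pos _
  calc _ ≤ P {ω | ENNReal.ofReal (Real.exp (a ^ 2 / (2 * b))) ≤ liminf (fun n ↦ g n ω) atTop} :=
        measure_mono_ae (by filter_upwards [hsub] with ω hω using hω)
    _ ≤ (∫⁻ ω, liminf (fun n ↦ g n ω) atTop ∂P) / ENNReal.ofReal (Real.exp (a ^ 2 / (2 * b))) :=
        meas_ge_le_lintegral_div (Measurable.liminf hgm).aemeasurable (by simpa using hpos)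
          ENNReal.ofReal_ne_top
    _ ≤ 1 / ENNReal.ofReal (Real.exp (a ^ 2 / (2 * b))) := ENNReal.div_le_div_right hlim _
    _ = _ := by
        rw [one_div, ← ENNReal.ofReal_inv_of_pos hpos, Real.exp_neg]

/-- The exponential (Gaussian) tail bound for Walsh integrals on the event that the quadratic
variation is at most `b`. -/
lemma measure_abs_ge_le (hW : IsWhiteNoise W F P) {h : Ω × (ℝ × Torus) → ℝ} {I : Ω → ℝ}
    (hI : IsWalshIntegral W F P h I) {a b : ℝ} (ha : 0 ≤ a) (hb : 0 < b) :
    P {ω | a ≤ |I ω| ∧ ∫⁻ z, ‖h (ω, z)‖ₑ ^ 2 ∂spaceTime ≤ ENNReal.ofReal b} ≤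
      2 * ENNReal.ofReal (Real.exp (-(a ^ 2 / (2 * b)))) := by
  have h1 := hI.measure_ge_le hW ha hb
  have h2 := (IsWalshIntegral.zero.sub hW hI).measure_ge_le hW ha hb
  simp only [Pi.zero_apply, zero_sub, enorm_neg] at h2
  rw [two_mul]
  refine le_trans (measure_mono ?_) ((measure_union_le _ _).trans (add_le_add h1 h2))
  rintro ω ⟨h3, h4⟩
  rcases le_abs.1 h3 with h5 | h5
  · exact Or.inl ⟨h5, h4⟩
  · exact Or.inr ⟨h5, h4⟩

end IsWalshIntegral

end SHE

end

/-! ### Quadratic variation of increments and probability of the bad chaining event. -/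

noncomputable section

namespace SHE

variable {Ω : Type*} {m : MeasurableSpace Ω} {P : Measure Ω} {F : Filtration ℝ m}
  {W : Set (ℝ × Torus) → Ω → ℝ} {σ : ℝ → ℝ} {u₀ : Ω → C(Torus, ℝ)} {u : ℝ → Torus → Ω → ℝ}

/-- The stochastic convolution part `u(s, x) - (P_s u₀)(x)` of a mild solution, extended by `0` to
time `0`. -/
def noisePart (u₀ : Ω → C(Torus, ℝ)) (u : ℝ → Torus → Ω → ℝ) (s : ℝ) (x : Torus) (ω : Ω) : ℝ :=
  if 0 < s then u s x ω - heatSemigroup s (u₀ ω) x else 0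

/-- The quadratic variation of the difference of the stochastic convolutions at two space-time
points. -/
def incrVariation (σ : ℝ → ℝ) (u : ℝ → Torus → Ω → ℝ) (s : ℝ) (x : Torus) (s' : ℝ) (x' : Torus)
    (ω : Ω) : ℝ≥0∞ :=
  ∫⁻ z, ‖mildKernel s x z * σ (u z.1 z.2 ω) - mildKernel s' x' z * σ (u z.1 z.2 ω)‖ₑ ^ 2 ∂spaceTime

lemma ae_spaceTime_pos : ∀ᵐ z ∂spaceTime, 0 < z.1 := by
  have h : ∀ᵐ r ∂(volume.restrict (Ioi (0 : ℝ))), 0 < r := ae_restrict_mem measurableSet_Ioi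
  exact Measure.quasiMeasurePreserving_fst.ae h

lemma IsMildSolution.isWalshIntegral (hu : IsMildSolution W F P σ u₀ u) {s : ℝ} (hs : 0 ≤ s)
    (x : Torus) :
    IsWalshIntegral W F P (fun z ↦ mildKernel s x z.2 * σ (u z.2.1 z.2.2 z.1))
      (noisePart u₀ u s x) := by
  rcases hs.eq_or_lt with rfl | hs
  · have h0 : noisePart u₀ u 0 x = 0 := by
      ext ω
      simp [noisePart]
    rw [h0]
    refine IsWalshIntegral.zero.congr ?_
    have h : ∀ᵐ z ∂(P.prod spaceTime), 0 < z.2.1 :=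
      Measure.quasiMeasurePreserving_snd.ae ae_spaceTime_pos
    filter_upwards [h] with z hz
    simp [mildKernel, hz.not_gt]
  · have h := hu.mild s hs x
    have h0 : noisePart u₀ u s x = fun ω ↦ u s x ω - heatSemigroup s (u₀ ω) x := by
      ext ω
      simp [noisePart, hs]
    rw [h0]
    convert! h using 1
    ext z
    simp [mildKernel, ite_mul]

lemma IsMildSolution.measure_incr_le [IsProbabilityMeasure P] (hW : IsWhiteNoise W F P)
    (hu : IsMildSolution W F P σ u₀ u) {s s' : ℝ} (hs : 0 ≤ s) (hs' : 0 ≤ s') (x x' : Torus)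
    {a b : ℝ} (ha : 0 ≤ a) (hb : 0 < b) :
    P {ω | a ≤ |noisePart u₀ u s x ω - noisePart u₀ u s' x' ω| ∧
        incrVariation σ u s x s' x' ω ≤ ENNReal.ofReal b} ≤
      2 * ENNReal.ofReal (Real.exp (-(a ^ 2 / (2 * b)))) :=
  ((hu.isWalshIntegral hs x).sub hW (hu.isWalshIntegral hs' x')).measure_abs_ge_le hW ha hb

/-- The solution is bounded by `M` up to time `s`, so the quadratic variation of an increment before
time `s` is controlled by the mean-square modulus of continuity of the kernel. -/
lemma exists_incrVariation_le : ∃ C : ℝ, 0 < C ∧ ∀ {Ω : Type*} {ϖ : ℝ≥0} {σ : ℝ → ℝ},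
    LipschitzWith ϖ σ → σ 0 = 0 → ∀ {u : ℝ → Torus → Ω → ℝ} {M : ℝ}, 0 ≤ M →
    ∀ {s s' : ℝ}, 0 ≤ s' → s' ≤ s → s ≤ 1 → ∀ (x x' : Torus) (h : ℝ), x - x' = (h : Torus) →
    ∀ ω, (∀ r, 0 ≤ r → r ≤ s → ∀ y, |u r y ω| ≤ M) →
      incrVariation σ u s x s' x' ω ≤
        ENNReal.ofReal ((ϖ * M) ^ 2 * (C * √(√(s - s') + |h|) * √√s)) := by
  obtain ⟨C, hC, hker⟩ := exists_lintegral_mildKernel_sub_le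
  refine ⟨C, hC, fun {Ω ϖ σ} hσ hσ0 {u M} hM {s s'} hs' hss hs1 x x' h hx ω hu ↦ ?_⟩
  rw [ENNReal.ofReal_mul (by positivity)]
  refine le_trans ?_ (mul_le_mul_right (hker s s' hs' hss hs1 x x' h hx) _)
  rw [← lintegral_const_mul' _ _ ENNReal.ofReal_ne_top]
  refine lintegral_mono_ae ?_
  filter_upwards [ae_spaceTime_pos] with z hz
  rw [← sub_mul]
  rcases lt_or_ge z.1 s with h1 | h1
  · have h2 : |σ (u z.1 z.2 ω)| ≤ ϖ * M := by
      have h3 := hσ.dist_le_mul (u z.1 z.2 ω) 0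
      rw [hσ0, Real.dist_eq, Real.dist_eq, sub_zero, sub_zero] at h3
      exact h3.trans (by gcongr; exact hu _ hz.le h1.le _)
    rw [enorm_mul, mul_pow, mul_comm]
    gcongr
    rw [Real.enorm_eq_ofReal_abs, ← ENNReal.ofReal_pow (abs_nonneg _)]
    gcongr
  · simp [mildKernel, h1.not_gt, (hss.trans h1).not_gt]

/-- Time coordinates of the chaining grid of level `n` for the time horizon `t`. -/
def gridTime (t : ℝ) (n k : ℕ) : ℝ := k / ((16 ^ 4 : ℕ) ^ n / (2 * t))

/-- Space coordinates of the chaining grid of level `n` for the time horizon `t`. -/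
def gridSpace (t : ℝ) (n j : ℕ) : ℝ := j / ((16 ^ 2 : ℕ) ^ n / √t)

/-- The event that some increment of the stochastic convolution along the chaining grid is large
although its quadratic variation is small. -/
def chainBad (σ : ℝ → ℝ) (u₀ : Ω → C(Torus, ℝ)) (u : ℝ → Torus → Ω → ℝ) (t a B : ℝ) : Set Ω :=
  ⋃ n : ℕ, ⋃ k ∈ Finset.range ((16 ^ 4) ^ (n + 1)),
    ⋃ j ∈ Finset.range (⌊2 * ((16 ^ 2 : ℕ) ^ (n + 1) / √t)⌋₊ + 1),
      {ω | a / 2 ^ (n + 1) ≤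
          |noisePart u₀ u (gridTime t (n + 1) k) (gridSpace t (n + 1) j : ℝ) ω -
            noisePart u₀ u (gridTime t n (k / 16 ^ 4)) (gridSpace t n (j / 16 ^ 2) : ℝ) ω| ∧
        incrVariation σ u (gridTime t (n + 1) k) (gridSpace t (n + 1) j : ℝ)
          (gridTime t n (k / 16 ^ 4)) (gridSpace t n (j / 16 ^ 2) : ℝ) ω ≤
            ENNReal.ofReal (B / 16 ^ n)}

lemma gridTime_nonneg {t : ℝ} (ht : 0 < t) (n k : ℕ) : 0 ≤ gridTime t n k := by
  unfold gridTime
  positivity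

/-- Sums the union bound over levels: 2^{24} = 16⁴·16² is the growth of the number of grid points
per level. -/
lemma exists_tsum_exp_le : ∃ C : ℝ, 0 < C ∧ ∀ z : ℝ, 0 < z →
    ∑' n : ℕ, ENNReal.ofReal ((2 ^ 24) ^ (n + 1) * Real.exp (-(z * 4 ^ n))) ≤
      ENNReal.ofReal (C * (z ^ 13)⁻¹ * Real.exp (-(z / 2))) := by
  have hfac : (0 : ℝ) < (Nat.factorial 13 : ℝ) := by positivity
  refine ⟨2 ^ 24 * (2 ^ 13 * (Nat.factorial 13 : ℝ)) * 2, by positivity, fun z hz ↦ ?_⟩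
  set A : ℝ := 2 ^ 24 * (2 ^ 13 * (Nat.factorial 13 : ℝ)) * (z ^ 13)⁻¹ * Real.exp (-(z / 2)) with hA
  have hterm : ∀ n : ℕ, (2 ^ 24 : ℝ) ^ (n + 1) * Real.exp (-(z * 4 ^ n)) ≤ A * (1 / 2) ^ n := by
    intro n
    have h4 : (1 : ℝ) ≤ 4 ^ n := one_le_pow₀ (by norm_num)
    have h1 : Real.exp (-(z * 4 ^ n)) = Real.exp (-(z * 4 ^ n / 2)) * Real.exp (-(z * 4 ^ n / 2)) := by
      rw [← Real.exp_add]
      ring_nf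
    have h2 : Real.exp (-(z * 4 ^ n / 2)) ≤ Real.exp (-(z / 2)) := by
      apply Real.exp_le_exp.2
      nlinarith
    -- The power 13 is the first with 4^{13} = 2^{26} > 2^{24}, which leaves a geometric factor
    -- 4^{-n}. The other half of the exponent is kept as e^{-z/2}.
    have h3 : Real.exp (-(z * 4 ^ n / 2)) ≤
        2 ^ 13 * (Nat.factorial 13 : ℝ) * (z ^ 13)⁻¹ * ((4 ^ n) ^ 13)⁻¹ := by
      have h5 := Real.pow_div_factorial_le_exp (z * 4 ^ n / 2) (by positivity) 13
      rw [Real.exp_neg]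
      refine (inv_anti₀ (by positivity) h5).trans (le_of_eq ?_)
      rw [div_pow, mul_pow]
      field_simp
    have h6 : (2 ^ 24 : ℝ) ^ (n + 1) * ((4 ^ n) ^ 13)⁻¹ ≤ 2 ^ 24 * (1 / 2) ^ n := by
      have e : ((4 : ℝ) ^ n) ^ 13 = (2 ^ 24) ^ n * 4 ^ n := by
        rw [← pow_mul, mul_comm n 13, pow_mul, ← mul_pow]
        norm_num
      rw [e, pow_succ]
      have e2 : ((2 : ℝ) ^ 24) ^ n * 2 ^ 24 * ((2 ^ 24) ^ n * 4 ^ n)⁻¹ = 2 ^ 24 * (1 / 4) ^ n := by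
        rw [div_pow, one_pow]
        field_simp
      rw [e2]
      gcongr
      norm_num
    calc (2 ^ 24 : ℝ) ^ (n + 1) * Real.exp (-(z * 4 ^ n))
        ≤ (2 ^ 24 : ℝ) ^ (n + 1) * ((2 ^ 13 * (Nat.factorial 13 : ℝ) * (z ^ 13)⁻¹ *
            ((4 ^ n) ^ 13)⁻¹) * Real.exp (-(z / 2))) := by
          rw [h1]
          gcongr
      _ = ((2 ^ 24 : ℝ) ^ (n + 1) * ((4 ^ n) ^ 13)⁻¹) *
            (2 ^ 13 * (Nat.factorial 13 : ℝ) * (z ^ 13)⁻¹ * Real.exp (-(z / 2))) := by ring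
      _ ≤ (2 ^ 24 * (1 / 2) ^ n) *
            (2 ^ 13 * (Nat.factorial 13 : ℝ) * (z ^ 13)⁻¹ * Real.exp (-(z / 2))) := by gcongr
      _ = _ := by rw [hA]; ring
  have hA0 : 0 ≤ A := by positivity
  have hgeo : HasSum (fun n : ℕ ↦ A * (1 / 2 : ℝ) ^ n) (A * 2) := hasSum_geometric_two.mul_left A
  refine (ENNReal.tsum_le_tsum fun n ↦ ENNReal.ofReal_le_ofReal (hterm n)).trans ?_
  rw [← ENNReal.ofReal_tsum_of_nonneg (fun n ↦ by positivity) hgeo.summable, hgeo.tsum_eq]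
  apply ENNReal.ofReal_le_ofReal
  rw [hA]
  apply le_of_eq
  ring

/-- Union bound. With threshold a/2^{n+1} and variation B/16^n, the Gaussian exponent at level n is
(a²/(8B))·4^n. The factor 1/√t counts spatial grid points of mesh proportional to √t. -/
lemma exists_measure_chainBad_le : ∃ C : ℝ, 0 < C ∧
    ∀ {Ω : Type*} {m : MeasurableSpace Ω} {P : Measure Ω} [IsProbabilityMeasure P]
      {F : Filtration ℝ m} {W : Set (ℝ × Torus) → Ω → ℝ} {σ : ℝ → ℝ} {u₀ : Ω → C(Torus, ℝ)}
      {u : ℝ → Torus → Ω → ℝ}, IsWhiteNoise W F P → IsMildSolution W F P σ u₀ u →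
      ∀ {t a B : ℝ}, 0 < t → t ≤ 1 → 0 < a → 0 < B →
        P (chainBad σ u₀ u t a B) ≤ ENNReal.ofReal (C / √t *
          ((a ^ 2 / (8 * B)) ^ 13)⁻¹ * Real.exp (-(a ^ 2 / (8 * B) / 2))) := by
  obtain ⟨C, hC, hsum⟩ := exists_tsum_exp_le
  refine ⟨6 * C, by positivity,
    fun {Ω m P _ F W σ u₀ u} hW hu {t a B} ht ht1 ha hB ↦ ?_⟩
  set z := a ^ 2 / (8 * B) with hz
  have hz0 : 0 < z := by positivity
  have hst : 0 < √t := Real.sqrt_pos.2 ht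
  have hst1 : √t ≤ 1 := Real.sqrt_le_one.2 ht1
  have hn : ∀ n : ℕ, P (⋃ k ∈ Finset.range ((16 ^ 4) ^ (n + 1)),
      ⋃ j ∈ Finset.range (⌊2 * ((16 ^ 2 : ℕ) ^ (n + 1) / √t)⌋₊ + 1),
      {ω | a / 2 ^ (n + 1) ≤
          |noisePart u₀ u (gridTime t (n + 1) k) (gridSpace t (n + 1) j : ℝ) ω -
            noisePart u₀ u (gridTime t n (k / 16 ^ 4)) (gridSpace t n (j / 16 ^ 2) : ℝ) ω| ∧
        incrVariation σ u (gridTime t (n + 1) k) (gridSpace t (n + 1) j : ℝ)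
          (gridTime t n (k / 16 ^ 4)) (gridSpace t n (j / 16 ^ 2) : ℝ) ω ≤
            ENNReal.ofReal (B / 16 ^ n)}) ≤
      ENNReal.ofReal (6 / √t) *
        ENNReal.ofReal ((2 ^ 24) ^ (n + 1) * Real.exp (-(z * 4 ^ n))) := by
    intro n
    have hexp : (a / 2 ^ (n + 1)) ^ 2 / (2 * (B / 16 ^ n)) = z * 4 ^ n := by
      have e : (16 : ℝ) ^ n = 4 ^ n * 4 ^ n := by rw [← mul_pow]; norm_num
      have e2 : ((2 : ℝ) ^ (n + 1)) ^ 2 = 4 * 4 ^ n := by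
        rw [← pow_mul, mul_comm, pow_mul, pow_succ]
        norm_num
        ring
      rw [div_pow, e2, e, hz]
      field_simp
      ring
    refine (measure_biUnion_finset_le _ _).trans ((Finset.sum_le_card_nsmul _ _
      (((⌊2 * ((16 ^ 2 : ℕ) ^ (n + 1) / √t)⌋₊ + 1 : ℕ) : ℝ≥0∞) *
        (2 * ENNReal.ofReal (Real.exp (-(z * 4 ^ n))))) fun k _ ↦ ?_).trans ?_)
    · refine (measure_biUnion_finset_le _ _).trans ((Finset.sum_le_card_nsmul _ _
        (2 * ENNReal.ofReal (Real.exp (-(z * 4 ^ n)))) fun j _ ↦ ?_).trans ?_)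
      · rw [← hexp]
        exact hu.measure_incr_le hW (gridTime_nonneg ht _ _) (gridTime_nonneg ht _ _) _ _
          (by positivity) (by positivity)
      · rw [Finset.card_range, nsmul_eq_mul]
    · rw [Finset.card_range, nsmul_eq_mul]
      have h2 : (2 : ℝ≥0∞) = ENNReal.ofReal 2 := by simp
      rw [h2, ← ENNReal.ofReal_natCast, ← ENNReal.ofReal_natCast,
        ← ENNReal.ofReal_mul (by positivity), ← ENNReal.ofReal_mul (by positivity),
        ← ENNReal.ofReal_mul (by positivity), ← ENNReal.ofReal_mul (by positivity)]
      apply ENNReal.ofReal_le_ofReal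
      have hfl := Nat.floor_le (R := ℝ) (a := 2 * ((16 ^ 2 : ℕ) ^ (n + 1) / √t)) (by positivity)
      have hone : 1 ≤ ((16 ^ 2 : ℕ) : ℝ) ^ (n + 1) / √t := by
        rw [le_div_iff₀ hst, one_mul]
        exact hst1.trans (one_le_pow₀ (by norm_num))
      set X := ((16 ^ 2 : ℕ) : ℝ) ^ (n + 1) / √t with hX
      have hcard : ((⌊2 * X⌋₊ + 1 : ℕ) : ℝ) ≤ 3 * X := by
        push_cast
        linarith
      have hpow : (((16 ^ 4) ^ (n + 1) : ℕ) : ℝ) * ((16 ^ 2 : ℕ) : ℝ) ^ (n + 1) =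
          (2 ^ 24) ^ (n + 1) := by
        push_cast
        rw [← mul_pow]
        norm_num
      calc _ ≤ (((16 ^ 4) ^ (n + 1) : ℕ) : ℝ) *
            (3 * X * (2 * Real.exp (-(z * 4 ^ n)))) := by gcongr
        _ = 6 / √t * ((((16 ^ 4) ^ (n + 1) : ℕ) : ℝ) * ((16 ^ 2 : ℕ) : ℝ) ^ (n + 1) *
              Real.exp (-(z * 4 ^ n))) := by rw [hX]; ring
        _ = _ := by rw [hpow]
  refine (measure_iUnion_le _).trans ((ENNReal.tsum_le_tsum hn).trans ?_)
  rw [ENNReal.tsum_mul_left]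
  refine (mul_le_mul_right (hsum z hz0) _).trans ?_
  rw [← ENNReal.ofReal_mul (by positivity)]
  apply ENNReal.ofReal_le_ofReal
  apply le_of_eq
  ring

end SHE

end

/-! ### Pathwise chaining. -/

noncomputable section

namespace SHE

/-- The rounding of `v` down to the grid of mesh `1 / c`. -/
lemma floor_div_bounds {v c : ℝ} (hv : 0 ≤ v) (hc : 0 < c) :
    (⌊v * c⌋₊ : ℝ) / c ≤ v ∧ v - 1 / c < (⌊v * c⌋₊ : ℝ) / c := by
  constructor
  · rw [div_le_iff₀ hc]
    exact Nat.floor_le (by positivity)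
  · rw [lt_div_iff₀ hc, sub_mul, one_div, inv_mul_cancel₀ hc.ne']
    have := Nat.lt_floor_add_one (v * c)
    linarith

/-- Successive roundings of one point are linked by integer division, which is how `chainBad` pairs
an index with its parent. -/
lemma floor_mul_pow_succ_div (v : ℝ) (b n : ℕ) (hb : 0 < b) (w : ℝ) :
    ⌊v * ((b : ℝ) ^ (n + 1) / w)⌋₊ / b = ⌊v * ((b : ℝ) ^ n / w)⌋₊ := by
  rw [← Nat.floor_div_natCast]
  congr 1
  have : (b : ℝ) ≠ 0 := by positivity
  rw [pow_succ]
  field_simp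

lemma natDiv_div_le (b n k : ℕ) (hb : 0 < b) {w : ℝ} (hw : 0 < w) :
    ((k / b : ℕ) : ℝ) / ((b : ℝ) ^ n / w) ≤ (k : ℝ) / ((b : ℝ) ^ (n + 1) / w) := by
  have hb' : (0 : ℝ) < b := by exact_mod_cast hb
  have h1 : ((k / b : ℕ) : ℝ) * b ≤ k := by exact_mod_cast Nat.div_mul_le_self k b
  rw [div_le_div_iff₀ (by positivity) (by positivity), pow_succ]
  calc _ = (((k / b : ℕ) : ℝ) * b) * ((b : ℝ) ^ n / w) := by ring
    _ ≤ _ := mul_le_mul_of_nonneg_right h1 (by positivity)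

lemma tendsto_floor_mul_pow_div {v w : ℝ} (hv : 0 ≤ v) (hw : 0 < w) {b : ℕ} (hb : 1 < b) :
    Tendsto (fun n : ℕ ↦ (⌊v * ((b : ℝ) ^ n / w)⌋₊ : ℝ) / ((b : ℝ) ^ n / w)) atTop (𝓝 v) := by
  have h : Tendsto (fun n : ℕ ↦ (b : ℝ) ^ n / w) atTop atTop :=
    (tendsto_pow_atTop_atTop_of_one_lt (by exact_mod_cast hb)).atTop_div_const hw
  exact (tendsto_nat_floor_mul_div_atTop hv).comp h

lemma abs_le_of_chain {f : ℕ → ℝ} {a l : ℝ} (h0 : f 0 = 0)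
    (hf : ∀ n, |f (n + 1) - f n| ≤ a / 2 ^ (n + 1)) (hl : Tendsto f atTop (𝓝 l)) : |l| ≤ a := by
  have ha : 0 ≤ a := by
    have := (abs_nonneg _).trans (hf 0)
    norm_num at this
    linarith
  have hn : ∀ n, |f n| ≤ a - a / 2 ^ n := by
    intro n
    induction n with
    | zero => simp [h0]
    | succ n ih =>
      have h1 : f (n + 1) = (f (n + 1) - f n) + f n := by ring
      have h2 := abs_add_le (f (n + 1) - f n) (f n)
      rw [← h1] at h2
      have h3 : a / 2 ^ n = a / 2 ^ (n + 1) + a / 2 ^ (n + 1) := by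
        rw [pow_succ]
        field_simp
        norm_num
      have := hf n
      linarith
  refine le_of_tendsto hl.abs (Eventually.of_forall fun n ↦ (hn n).trans ?_)
  have : 0 ≤ a / 2 ^ n := by positivity
  linarith

/-- Parabolic scaling: the time mesh is of order t/16^{4n} and the space mesh √t/16^{2n}, so √δ and
|h| are comparable. Together with the factor t^{1/4} of the kernel estimate this yields √t/16^n. -/
lemma sqrt_mesh_le {t : ℝ} (ht : 0 < t) (n : ℕ) {δ h : ℝ}
    (hδ : δ ≤ 1 / (((16 ^ 4 : ℕ) : ℝ) ^ n / (2 * t))) (hh : |h| ≤ 1 / (((16 ^ 2 : ℕ) : ℝ) ^ n / √t)) :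
    √(√δ + |h|) ≤ 2 * √√t / 16 ^ n := by
  have hst : 0 < √t := Real.sqrt_pos.2 ht
  have e4 : ((16 ^ 4 : ℕ) : ℝ) ^ n = (16 ^ n) ^ 4 := by
    rw [show ((16 ^ 4 : ℕ) : ℝ) = (16 : ℝ) ^ 4 by norm_num, ← pow_mul, ← pow_mul, mul_comm]
  have e2 : ((16 ^ 2 : ℕ) : ℝ) ^ n = (16 ^ n) ^ 2 := by
    rw [show ((16 ^ 2 : ℕ) : ℝ) = (16 : ℝ) ^ 2 by norm_num, ← pow_mul, ← pow_mul, mul_comm]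
  rw [e4] at hδ
  rw [e2] at hh
  set q : ℝ := 16 ^ n with hq
  have hq0 : 0 < q := by positivity
  clear_value q
  have h1 : √δ ≤ 2 * √t / q ^ 2 := by
    apply Real.sqrt_le_iff.2 ⟨by positivity, hδ.trans _⟩
    rw [div_pow, mul_pow, Real.sq_sqrt ht.le, one_div_div]
    have e : (q ^ 2) ^ 2 = q ^ 4 := by ring
    rw [e]
    gcongr
    norm_num
  have h2 : |h| ≤ √t / q ^ 2 := by rwa [one_div_div] at hh
  apply Real.sqrt_le_iff.2 ⟨by positivity, _⟩
  rw [div_pow, mul_pow, Real.sq_sqrt hst.le]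
  calc √δ + |h| ≤ 2 * √t / q ^ 2 + √t / q ^ 2 := by gcongr
    _ = 3 * √t / q ^ 2 := by ring
    _ ≤ _ := by gcongr; norm_num

/-- Chaining: off the bad event, the stochastic convolution is at most `a` as long as the solution
stays below `M`. -/
lemma exists_abs_noisePart_le : ∃ C : ℝ, 0 < C ∧ ∀ {Ω : Type*} {ϖ : ℝ≥0} {σ : ℝ → ℝ},
    LipschitzWith ϖ σ → σ 0 = 0 → ∀ {u₀ : Ω → C(Torus, ℝ)} {u : ℝ → Torus → Ω → ℝ} {M : ℝ}, 0 ≤ M →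
    ∀ {t a : ℝ}, 0 < t → t ≤ 1 → 0 ≤ a → ∀ {ω : Ω},
      ContinuousOn (fun z : ℝ × Torus ↦ u z.1 z.2 ω) (Ici 0 ×ˢ univ) →
      ω ∉ chainBad σ u₀ u t a (C * (ϖ * M) ^ 2 * √t) →
      ∀ {s : ℝ}, 0 ≤ s → s ≤ t → (∀ r, 0 ≤ r → r ≤ s → ∀ y, |u r y ω| ≤ M) →
      ∀ x : Torus, |noisePart u₀ u s x ω| ≤ a := by
  obtain ⟨C, hC, hvar⟩ := exists_incrVariation_le
  refine ⟨2 * C, by positivity, fun {Ω ϖ σ} hσ hσ0 {u₀ u M} hM {t a} ht ht1 ha {ω} hcont hω {s}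
    hs hst hu x ↦ ?_⟩
  rcases hs.eq_or_lt with rfl | hs0
  · simpa [noisePart] using ha
  obtain ⟨v, hv, rfl⟩ : ∃ v ∈ Ico (0 : ℝ) 2, (v : Torus) = x := by
    refine ⟨_, ?_, AddCircle.coe_equivIco (p := (2 : ℝ)) (a := 0) (y := x)⟩
    simpa using (AddCircle.equivIco (2 : ℝ) 0 x).2
  have hsqt : 0 < √t := Real.sqrt_pos.2 ht
  -- Rounding down keeps every grid time at most s, so the variation bounds use |u| ≤ M only up to
  -- time s, as the exit argument requires.
  let k : ℕ → ℕ := fun n ↦ ⌊s * (((16 ^ 4 : ℕ) : ℝ) ^ n / (2 * t))⌋₊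
  let j : ℕ → ℕ := fun n ↦ ⌊v * (((16 ^ 2 : ℕ) : ℝ) ^ n / √t)⌋₊
  have hk : ∀ n, k (n + 1) / 16 ^ 4 = k n := fun n ↦
    floor_mul_pow_succ_div s (16 ^ 4) n (by positivity) _
  have hj : ∀ n, j (n + 1) / 16 ^ 2 = j n := fun n ↦
    floor_mul_pow_succ_div v (16 ^ 2) n (by positivity) _
  let τ : ℕ → ℝ := fun n ↦ gridTime t n (k n)
  let ξ : ℕ → ℝ := fun n ↦ gridSpace t n (j n)
  have hτ : ∀ n, τ n ≤ s ∧ s - 1 / (((16 ^ 4 : ℕ) : ℝ) ^ n / (2 * t)) < τ n := fun n ↦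
    floor_div_bounds hs (by positivity)
  have hξ : ∀ n, ξ n ≤ v ∧ v - 1 / (((16 ^ 2 : ℕ) : ℝ) ^ n / √t) < ξ n := fun n ↦
    floor_div_bounds hv.1 (by positivity)
  have hτ0 : ∀ n, 0 ≤ τ n := fun n ↦ gridTime_nonneg ht _ _
  have hτmono : ∀ n, τ n ≤ τ (n + 1) := fun n ↦ by
    simp only [τ, gridTime]
    rw [← hk n]
    exact natDiv_div_le _ _ _ (by positivity) (by positivity)
  have hξmono : ∀ n, ξ n ≤ ξ (n + 1) := fun n ↦ by
    simp only [ξ, gridSpace]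
    rw [← hj n]
    exact natDiv_div_le _ _ _ (by positivity) (by positivity)
  have hbad : ∀ n, |noisePart u₀ u (τ (n + 1)) (ξ (n + 1) : ℝ) ω -
      noisePart u₀ u (τ n) (ξ n : ℝ) ω| ≤ a / 2 ^ (n + 1) := by
    intro n
    by_contra! hlt
    refine hω ?_
    simp only [chainBad, mem_iUnion]
    refine ⟨n, k (n + 1), ?_, j (n + 1), ?_, ?_, ?_⟩
    · rw [Finset.mem_range, Nat.floor_lt (by positivity)]
      rw [show (((16 ^ 4) ^ (n + 1) : ℕ) : ℝ) = ((16 ^ 4 : ℕ) : ℝ) ^ (n + 1) from Nat.cast_pow _ _,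
        mul_div_assoc', div_lt_iff₀ (by positivity)]
      have : (0 : ℝ) < ((16 ^ 4 : ℕ) : ℝ) ^ (n + 1) := by positivity
      nlinarith [mul_lt_mul_of_pos_left (show s < 2 * t by linarith) this]
    · rw [Finset.mem_range, Nat.lt_add_one_iff]
      apply Nat.floor_le_floor
      gcongr
      exact hv.2.le
    · rw [hk, hj]
      exact hlt.le
    · rw [hk, hj]
      have h1 := hvar hσ hσ0 (u := u) hM (hτ0 n) (hτmono n) ((hτ (n + 1)).1.trans (hst.trans ht1))
        (ξ (n + 1) : ℝ) (ξ n : ℝ) (ξ (n + 1) - ξ n) rfl ω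
        (fun r hr hr' ↦ hu r hr (hr'.trans (hτ (n + 1)).1))
      refine h1.trans (ENNReal.ofReal_le_ofReal ?_)
      have h2 := sqrt_mesh_le ht n (δ := τ (n + 1) - τ n) (h := ξ (n + 1) - ξ n)
        (by linarith [(hτ (n + 1)).1, (hτ n).2])
        (by rw [abs_of_nonneg (by linarith [hξmono n])]; linarith [(hξ (n + 1)).1, (hξ n).2])
      have h3 : √√(τ (n + 1)) ≤ √√t := by
        gcongr
        exact (hτ (n + 1)).1.trans hst
      calc (ϖ * M) ^ 2 * (C * √(√(τ (n + 1) - τ n) + |ξ (n + 1) - ξ n|) * √√(τ (n + 1)))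
          ≤ (ϖ * M) ^ 2 * (C * (2 * √√t / 16 ^ n) * √√t) := by gcongr
        _ = 2 * C * (ϖ * M) ^ 2 * (√√t * √√t) / 16 ^ n := by ring
        _ = _ := by rw [Real.mul_self_sqrt hsqt.le]
  -- The level-0 time mesh is 2t > s, so the chain starts at time 0, where the noise part vanishes
  -- and no initial estimate is needed.
  have hzero : noisePart u₀ u (τ 0) (ξ 0 : ℝ) ω = 0 := by
    have : k 0 = 0 := by
      simp only [k, pow_zero, Nat.floor_eq_zero]
      rw [mul_one_div, div_lt_one (by positivity)]
      linarith
    simp [τ, gridTime, this, noisePart]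
  have hτlim : Tendsto τ atTop (𝓝 s) :=
    tendsto_floor_mul_pow_div hs (by positivity) (by norm_num)
  have hξlim : Tendsto ξ atTop (𝓝 v) :=
    tendsto_floor_mul_pow_div hv.1 hsqt (by norm_num)
  have hpair : Tendsto (fun n ↦ (τ n, ((ξ n : ℝ) : Torus))) atTop (𝓝 (s, (v : Torus))) :=
    hτlim.prodMk_nhds (((AddCircle.continuous_mk' (2 : ℝ)).tendsto v).comp hξlim)
  have hnhds : Ioi (0 : ℝ) ×ˢ (univ : Set Torus) ∈ 𝓝 (s, (v : Torus)) :=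
    (isOpen_Ioi.prod isOpen_univ).mem_nhds ⟨hs0, mem_univ _⟩
  have hc : ContinuousAt (fun q : ℝ × Torus ↦ u q.1 q.2 ω - heatSemigroup q.1 (u₀ ω) q.2)
      (s, (v : Torus)) :=
    ((hcont.mono (prod_mono Ioi_subset_Ici_self subset_rfl)).sub
      (continuousOn_heatSemigroup (u₀ ω))).continuousAt hnhds
  refine abs_le_of_chain (f := fun n ↦ noisePart u₀ u (τ n) (ξ n : ℝ) ω) hzero hbad ?_
  have h1 := hc.tendsto.comp hpair
  have h2 : noisePart u₀ u s (v : Torus) ω = u s v ω - heatSemigroup s (u₀ ω) v := by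
    simp [noisePart, hs0]
  rw [h2]
  refine h1.congr' ?_
  filter_upwards [hτlim.eventually_const_lt hs0] with n hn
  simp [noisePart, hn]

end SHE

end

/-! ### Absorbing prefactors, sup norms, and the first-exit argument. -/

noncomputable section

namespace SHE

lemma exists_mul_exp_neg_rpow_le {β : ℝ} (hβ : 0 < β) :
    ∃ A : ℝ, 0 < A ∧ ∀ N : ℝ, 1 ≤ N → N * Real.exp (-N ^ β) ≤ A := by
  obtain ⟨k, hk⟩ := exists_nat_ge (1 / β)
  refine ⟨(Nat.factorial k : ℝ), by positivity, fun N hN ↦ ?_⟩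
  have hN0 : 0 < N := by linarith
  have h1 : N ≤ (N ^ β) ^ k := by
    rw [← Real.rpow_mul_natCast hN0.le]
    have : 1 ≤ β * k := by
      rw [div_le_iff₀ hβ] at hk
      linarith
    calc N = N ^ (1 : ℝ) := (Real.rpow_one N).symm
      _ ≤ _ := Real.rpow_le_rpow_of_exponent_le hN this
  have h2 := Real.pow_div_factorial_le_exp (N ^ β) (by positivity) k
  rw [div_le_iff₀ (by positivity)] at h2
  rw [Real.exp_neg, mul_inv_le_iff₀ (Real.exp_pos _)]
  linarith

/-- Half of the exponent absorbs the prefactor and the other half eventually dominates N^β since p >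
β. -/
lemma exists_rpow_mul_exp_neg_le {c β p : ℝ} (hc : 0 < c) (hβ : 0 < β) (hp : β < p) :
    ∃ A : ℝ, 0 < A ∧ ∀ N : ℝ, 1 ≤ N →
      N ^ p * Real.exp (-(c * N ^ p)) ≤ A * Real.exp (-N ^ β) := by
  -- Solves (c/2)·N^{p-β} = 1. Below it, N^β is simply bounded by N₀^β.
  set N₀ : ℝ := (2 / c) ^ (1 / (p - β)) with hN₀
  have hN₀0 : 0 < N₀ := by positivity
  refine ⟨2 / c * Real.exp (N₀ ^ β), by positivity, fun N hN ↦ ?_⟩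
  have hN0 : 0 < N := by linarith
  have h1 : N ^ β ≤ N₀ ^ β + c / 2 * N ^ p := by
    rcases le_total N₀ N with h | h
    · have h2 : 2 / c ≤ N ^ (p - β) := by
        have h3 := Real.rpow_le_rpow hN₀0.le h (show 0 ≤ p - β by linarith)
        rwa [hN₀, ← Real.rpow_mul (by positivity), one_div, inv_mul_cancel₀ (by linarith),
          Real.rpow_one] at h3
      have h4 : N ^ p = N ^ (p - β) * N ^ β := by
        rw [← Real.rpow_add hN0]
        ring_nf
      have h5 : 0 < N ^ β := by positivity
      have h6 : 0 < N₀ ^ β := by positivity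
      have h7 : 1 ≤ c / 2 * N ^ (p - β) := by
        calc (1 : ℝ) = c / 2 * (2 / c) := by field_simp
          _ ≤ _ := by gcongr
      rw [h4]
      nlinarith
    · have h2 := Real.rpow_le_rpow hN0.le h hβ.le
      have : 0 ≤ c / 2 * N ^ p := by positivity
      linarith
  have h2 : N ^ p ≤ 2 / c * Real.exp (c / 2 * N ^ p) := by
    have h3 := Real.add_one_le_exp (c / 2 * N ^ p)
    rw [div_mul_eq_mul_div, le_div_iff₀ hc]
    linarith
  calc N ^ p * Real.exp (-(c * N ^ p))
      ≤ 2 / c * Real.exp (c / 2 * N ^ p) * Real.exp (-(c * N ^ p)) := by gcongr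
    _ = 2 / c * Real.exp (-(c / 2 * N ^ p)) := by
        rw [mul_assoc, ← Real.exp_add]
        ring_nf
    _ ≤ 2 / c * Real.exp (N₀ ^ β + -N ^ β) := by
        gcongr
        linarith
    _ = _ := by rw [Real.exp_add]; ring

/-- For continuous f the exceptional set is open and null, hence empty. -/
lemma le_of_eLpNorm_top_le {f : C(Torus, ℝ)} {N : ℝ} (hN : 0 ≤ N)
    (h : eLpNorm f ∞ volume ≤ ENNReal.ofReal N) (x : Torus) : f x ≤ N := by
  rw [eLpNorm_exponent_top] at h
  have h1 : ∀ᵐ y : Torus, f y ≤ N := by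
    filter_upwards [ae_le_eLpNormEssSup (f := (f : Torus → ℝ)) (μ := volume)] with y hy
    have h2 := hy.trans h
    rw [Real.enorm_eq_ofReal_abs] at h2
    exact (le_abs_self _).trans ((ENNReal.ofReal_le_ofReal_iff hN).1 h2)
  have h2 : IsOpen {y : Torus | ¬ f y ≤ N} := by
    simp only [not_le]
    exact isOpen_lt continuous_const f.continuous
  have h3 := h2.measure_eq_zero_iff (μ := volume) |>.1 (ae_iff.1 h1)
  by_contra hx
  exact (h3 ▸ (show x ∈ {y : Torus | ¬ f y ≤ N} from hx) : x ∈ (∅ : Set Torus))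

lemma integral_eq_one_of_eLpNorm {f : C(Torus, ℝ)} (hf : ∀ x, 0 ≤ f x)
    (h : eLpNorm f 1 volume = 1) : ∫ y, f y = 1 := by
  rw [eLpNorm_one_eq_lintegral_enorm] at h
  have h1 := integral_norm_eq_lintegral_enorm (μ := (volume : Measure Torus))
    (f := (f : Torus → ℝ)) f.continuous.aestronglyMeasurable
  rw [h, ENNReal.toReal_one] at h1
  rw [← h1]
  congr 1
  ext y
  rw [Real.norm_of_nonneg (hf y)]

variable {Ω : Type*} {u₀ : Ω → C(Torus, ℝ)} {u : ℝ → Torus → Ω → ℝ}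

/-- If the stochastic convolution is at most `N / 2` for as long as the solution stays below `2N`,
then the solution never exceeds `3N / 2`. -/
lemma abs_le_of_noisePart_le {t N : ℝ} (hN : 0 < N) {ω : Ω}
    (hcont : ContinuousOn (fun z : ℝ × Torus ↦ u z.1 z.2 ω) (Ici 0 ×ˢ univ))
    (hinit : ∀ x, u 0 x ω = u₀ ω x) (h0 : ∀ x, 0 ≤ u₀ ω x) (hN0 : ∀ x, u₀ ω x ≤ N)
    (hnoise : ∀ s, 0 ≤ s → s ≤ t → (∀ r, 0 ≤ r → r ≤ s → ∀ y, |u r y ω| ≤ 2 * N) →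
      ∀ x, |noisePart u₀ u s x ω| ≤ N / 2) :
    ∀ s, 0 ≤ s → s ≤ t → ∀ x, |u s x ω| ≤ 3 / 2 * N := by
  have hstep : ∀ s, 0 ≤ s → s ≤ t → (∀ r, 0 ≤ r → r ≤ s → ∀ y, |u r y ω| ≤ 2 * N) →
      ∀ x, |u s x ω| ≤ 3 / 2 * N := by
    intro s hs hst hr x
    rcases hs.eq_or_lt with rfl | hs0
    · rw [hinit, abs_of_nonneg (h0 x)]
      linarith [hN0 x]
    · have h1 := hnoise s hs hst hr x
      rw [noisePart, if_pos hs0, abs_le] at h1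
      have h2 := heatSemigroup_nonneg h0 s x
      have h3 := heatSemigroup_le_of_le hN0 hs0 x
      rw [abs_le]
      constructor <;> linarith
  suffices hlt : ∀ s, 0 ≤ s → s ≤ t → ∀ x, |u s x ω| < 2 * N by
    intro s hs hst
    exact hstep s hs hst fun r hr hrs y ↦ (hlt r hr (hrs.trans hst) y).le
  by_contra! hex
  obtain ⟨s₁, hs₁, hs₁t, x₁, hx₁⟩ := hex
  let D : Set (ℝ × Torus) := Icc 0 t ×ˢ univ
  have hDc : IsCompact D := isCompact_Icc.prod isCompact_univ
  have hcD : ContinuousOn (fun z : ℝ × Torus ↦ |u z.1 z.2 ω|) D :=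
    (hcont.mono (prod_mono Icc_subset_Ici_self subset_rfl)).abs
  -- Minimising the time coordinate over this compact set produces the first time at which |u|
  -- reaches 2N somewhere.
  let E : Set (ℝ × Torus) := D ∩ (fun z : ℝ × Torus ↦ |u z.1 z.2 ω|) ⁻¹' Ici (2 * N)
  have hE : IsCompact E :=
    hDc.of_isClosed_subset (hcD.preimage_isClosed_of_isClosed hDc.isClosed isClosed_Ici)
      inter_subset_left
  obtain ⟨⟨τ, y₀⟩, ⟨⟨hτ', -⟩, hy₀⟩, hmin⟩ := hE.exists_isMinOn
    ⟨(s₁, x₁), ⟨⟨hs₁, hs₁t⟩, mem_univ _⟩, hx₁⟩ continuous_fst.continuousOn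
  have hτ : τ ∈ Icc 0 t := hτ'
  have hbefore : ∀ r, 0 ≤ r → r < τ → ∀ y, |u r y ω| < 2 * N := by
    intro r hr hrτ y
    by_contra! h
    have h1 : τ ≤ r := hmin (show (r, y) ∈ E from ⟨⟨⟨hr, hrτ.le.trans hτ.2⟩, mem_univ _⟩, h⟩)
    linarith
  -- The noise hypothesis at τ needs the bound up to and including τ. It passes to τ by left
  -- continuity, or comes from the initial condition if τ = 0.
  have hat : ∀ y, |u τ y ω| ≤ 2 * N := by
    intro y
    rcases hτ.1.eq_or_lt with h | h
    · rw [← h, hinit, abs_of_nonneg (h0 y)]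
      linarith [hN0 y]
    · have hc : ContinuousWithinAt (fun r : ℝ ↦ |u r y ω|) (Ico 0 τ) τ := by
        have h1 := (hcont (τ, y) ⟨hτ.1, mem_univ _⟩).abs
        exact h1.comp (f := fun r : ℝ ↦ (r, y)) (by fun_prop) (fun r hr ↦ ⟨hr.1, mem_univ _⟩)
      have hne : (𝓝[Ico 0 τ] τ).NeBot := by
        rw [← mem_closure_iff_nhdsWithin_neBot, closure_Ico h.ne]
        exact ⟨h.le, le_rfl⟩
      refine le_of_tendsto hc (eventually_nhdsWithin_of_forall fun r hr ↦ ?_)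
      exact (hbefore r hr.1 hr.2 y).le
  have h1 := hstep τ hτ.1 hτ.2 (fun r hr hrτ y ↦ by
    rcases hrτ.eq_or_lt with rfl | h
    · exact hat y
    · exact (hbefore r hr h y).le) y₀
  have h2 : 2 * N ≤ |u τ y₀ ω| := hy₀
  linarith

end SHE

end

/-! ### Choice of constants and conclusion. -/

theorem proposition3p7 (ϖ : ℝ≥0) (hϖ : 0 < ϖ) (γ : ℝ) (hγ : 4 / 3 < γ) (hγ' : γ < 2) :
    ∃ K : ℝ, 0 < K ∧
      ∀ {Ω : Type*} {m : MeasurableSpace Ω} (P : Measure Ω) [IsProbabilityMeasure P]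
        (F : Filtration ℝ m) (W : Set (ℝ × SHE.Torus) → Ω → ℝ) (_ : SHE.IsWhiteNoise W F P)
        (N : ℝ) (_ : 1 ≤ N)
        (σ : ℝ → ℝ) (_ : LipschitzWith ϖ σ) (_ : σ 0 = 0)
        (u₀ : Ω → C(SHE.Torus, ℝ))
        (_ : ∀ᵐ ω ∂P, (∀ x, 0 ≤ u₀ ω x) ∧ eLpNorm (u₀ ω) 1 volume = 1 ∧
          eLpNorm (u₀ ω) ∞ volume ≤ ENNReal.ofReal N)
        (u : ℝ → SHE.Torus → Ω → ℝ) (_ : SHE.IsMildSolution W F P σ u₀ u),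
        P {ω | ENNReal.ofReal (K * N ^ (γ / 2)) ≤
            eLpNorm (fun x ↦ u (N ^ (-γ)) x ω) ∞ volume}
          ≤ ENNReal.ofReal (K * Real.exp (-N ^ ((3 * γ - 4) / 2))) ∧
        P {ω | ENNReal.ofReal (2 * N) ≤
            ⨆ s ∈ Icc (0 : ℝ) (N ^ (-γ)), eLpNorm (fun x ↦ u s x ω) ∞ volume}
          ≤ ENNReal.ofReal (K * Real.exp (-(1 / 2) * N ^ ((3 * γ - 4) / 2))) := by
  obtain ⟨C₀, hC₀, hker⟩ := SHE.exists_heatKernel_zero_le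
  obtain ⟨C₁, hC₁, hprob⟩ := SHE.exists_measure_chainBad_le
  obtain ⟨C₂, hC₂, hchain⟩ := SHE.exists_abs_noisePart_le
  have hϖ' : (0 : ℝ) < ϖ := by exact_mod_cast hϖ
  set β : ℝ := (3 * γ - 4) / 2 with hβ
  have hβ0 : 0 < β := by rw [hβ]; linarith
  -- Chosen so that the chaining exponent a²/(8B) equals c N^{γ/2} when a = N/2. With a = N^{γ/2}/√c
  -- it is then 4 N^β.
  set c : ℝ := 1 / (128 * C₂ * ϖ ^ 2) with hc
  have hc0 : 0 < c := by positivity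
  obtain ⟨A₁, hA₁, hG₁⟩ := SHE.exists_mul_exp_neg_rpow_le hβ0
  obtain ⟨A₂, hA₂, hG₂⟩ := SHE.exists_rpow_mul_exp_neg_le (c := c / 2) (p := γ / 2)
    (by positivity) hβ0 (by rw [hβ]; linarith)
  set K₁ : ℝ := 1 / √c with hK₁
  have hK₁0 : 0 < K₁ := by positivity
  set Q₁ : ℝ := C₁ * A₁ with hQ₁
  set Q₂ : ℝ := C₁ * (c ^ 13)⁻¹ * A₂ with hQ₂
  have hQ₁0 : 0 < Q₁ := by positivity
  have hQ₂0 : 0 < Q₂ := by positivity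
  -- C₀ + K₁ bounds the solution at time t in units of N^{γ/2}, and Q₁ + Q₂ bounds the two bad
  -- events. As Q₁ + Q₂ > 0, the threshold strictly exceeds the good-event bound.
  refine ⟨C₀ + K₁ + Q₁ + Q₂, by positivity,
    fun {Ω m} P _ F W hW N hN σ hσ hσ0 u₀ hu₀ u hu ↦ ?_⟩
  have hN0 : 0 < N := by linarith
  set t : ℝ := N ^ (-γ) with ht
  have ht0 : 0 < t := by positivity
  have ht1 : t ≤ 1 := Real.rpow_le_one_of_one_le_of_nonpos hN (by linarith)
  set G : ℝ := N ^ (γ / 2) with hG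
  have hG0 : 0 < G := by positivity
  have hGN : G ≤ N := by
    calc G ≤ N ^ (1 : ℝ) := Real.rpow_le_rpow_of_exponent_le hN (by linarith)
      _ = N := Real.rpow_one N
  have hsqt : √t = G⁻¹ := by
    rw [Real.sqrt_eq_rpow, ht, hG, ← Real.rpow_mul hN0.le, ← Real.rpow_neg hN0.le]
    congr 1
    ring
  have hG3 : G ^ 3 = N ^ 2 * N ^ β := by
    rw [hG, ← Real.rpow_mul_natCast hN0.le, ← Real.rpow_natCast N 2, ← Real.rpow_add hN0, hβ]
    congr 1
    push_cast
    ring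
  set B : ℝ := C₂ * (ϖ * (2 * N)) ^ 2 * √t with hB
  have hB0 : 0 < B := by positivity
  have hNβ1 : 1 ≤ N ^ β := Real.one_le_rpow hN hβ0.le
  have hp₁ : P (SHE.chainBad σ u₀ u t (K₁ * G) B) ≤ ENNReal.ofReal (Q₁ * Real.exp (-N ^ β)) := by
    refine (hprob hW hu ht0 ht1 (by positivity) hB0).trans (ENNReal.ofReal_le_ofReal ?_)
    have hz : (K₁ * G) ^ 2 / (8 * B) = 4 * N ^ β := by
      rw [hB, hsqt, hK₁, mul_pow, div_pow, Real.sq_sqrt hc0.le, hc]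
      field_simp
      rw [hG3]
      ring
    rw [hz, hsqt, div_inv_eq_mul]
    have h1 : ((4 * N ^ β) ^ 13)⁻¹ ≤ 1 := inv_le_one_of_one_le₀ (one_le_pow₀ (by linarith))
    -- One of the two factors pays for the grid count 1/√t = N^{γ/2} ≤ N.
    have h2 : Real.exp (-(4 * N ^ β / 2)) = Real.exp (-N ^ β) * Real.exp (-N ^ β) := by
      rw [← Real.exp_add]
      ring_nf
    calc C₁ * G * ((4 * N ^ β) ^ 13)⁻¹ * Real.exp (-(4 * N ^ β / 2))
        ≤ C₁ * N * 1 * Real.exp (-(4 * N ^ β / 2)) := by gcongr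
      _ = C₁ * (N * Real.exp (-N ^ β)) * Real.exp (-N ^ β) := by rw [h2]; ring
      _ ≤ C₁ * A₁ * Real.exp (-N ^ β) := by gcongr; exact hG₁ N hN
  have hp₂ : P (SHE.chainBad σ u₀ u t (N / 2) B) ≤ ENNReal.ofReal (Q₂ * Real.exp (-N ^ β)) := by
    refine (hprob hW hu ht0 ht1 (by positivity) hB0).trans (ENNReal.ofReal_le_ofReal ?_)
    have hz : (N / 2) ^ 2 / (8 * B) = c * G := by
      rw [hB, hsqt, hc]
      field_simp
      norm_num
    rw [hz, hsqt, div_inv_eq_mul]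
    have hG1 : 1 ≤ G := Real.one_le_rpow hN (by linarith)
    have h1 : ((c * G) ^ 13)⁻¹ ≤ (c ^ 13)⁻¹ := by
      gcongr
      nlinarith
    calc C₁ * G * ((c * G) ^ 13)⁻¹ * Real.exp (-(c * G / 2))
        ≤ C₁ * G * (c ^ 13)⁻¹ * Real.exp (-(c * G / 2)) := by gcongr
      _ = C₁ * (c ^ 13)⁻¹ * (G * Real.exp (-(c / 2 * G))) := by
          rw [show c * G / 2 = c / 2 * G by ring]
          ring
      _ ≤ C₁ * (c ^ 13)⁻¹ * (A₂ * Real.exp (-N ^ β)) := mul_le_mul_of_nonneg_left (hG₂ N hN) (by positivity)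
      _ = _ := by rw [hQ₂]; ring
  have hgood : ∀ᵐ ω ∂P, ω ∉ SHE.chainBad σ u₀ u t (N / 2) B →
      (∀ s, 0 ≤ s → s ≤ t → ∀ x, |u s x ω| ≤ 3 / 2 * N) ∧
      (ω ∉ SHE.chainBad σ u₀ u t (K₁ * G) B → ∀ x, |u t x ω| ≤ (C₀ + K₁) * G) := by
    filter_upwards [hu₀, hu.initial, hu.continuous] with ω h1 hinit hcont hω
    obtain ⟨hpos, hL1, hLinf⟩ := h1
    have hmax := SHE.abs_le_of_noisePart_le hN0 hcont hinit hpos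
      (SHE.le_of_eLpNorm_top_le hN0.le hLinf)
      (fun s hs hst hr x ↦ hchain hσ hσ0 (by positivity) ht0 ht1 (by positivity) hcont hω hs hst hr x)
    refine ⟨hmax, fun hω' x ↦ ?_⟩
    -- The a priori bound from the first good event gives |u| ≤ 2N on all of [0, t], so the chaining
    -- can be rerun with the smaller threshold K₁N^{γ/2}.
    have h2 := hchain hσ hσ0 (M := 2 * N) (by positivity) ht0 ht1 (by positivity) hcont hω' ht0.le le_rfl
      (fun r hr hrt y ↦ (hmax r hr hrt y).trans (by linarith)) x
    rw [SHE.noisePart, if_pos ht0, abs_le] at h2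
    have h3 := SHE.heatSemigroup_nonneg hpos t x
    have h4 := SHE.heatSemigroup_le_mul_integral hpos ht0 x
    rw [SHE.integral_eq_one_of_eLpNorm hpos hL1, mul_one] at h4
    have h5 := hker t ht0 (by linarith)
    rw [hsqt, div_inv_eq_mul] at h5
    have h6 : 0 < C₀ * G := by positivity
    rw [abs_le]
    constructor <;> nlinarith
  have hess : ∀ (s b : ℝ) (ω : Ω), (∀ x, |u s x ω| ≤ b) →
      eLpNorm (fun x ↦ u s x ω) ∞ volume ≤ ENNReal.ofReal b := fun s b ω h ↦ by
    rw [eLpNorm_exponent_top]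
    refine eLpNormEssSup_le_of_ae_bound (ae_of_all _ fun x ↦ ?_)
    simpa using h x
  constructor
  · calc _ ≤ P (SHE.chainBad σ u₀ u t (N / 2) B ∪ SHE.chainBad σ u₀ u t (K₁ * G) B) := by
          refine measure_mono_ae ?_
          filter_upwards [hgood] with ω hω hbig
          by_contra hnot
          have hnot' : ω ∉ SHE.chainBad σ u₀ u t (N / 2) B ∪ SHE.chainBad σ u₀ u t (K₁ * G) B := hnot
          rw [mem_union, not_or] at hnot'
          have h1 := hess t _ ω ((hω hnot'.1).2 hnot'.2)
          have h2 : ENNReal.ofReal ((C₀ + K₁ + Q₁ + Q₂) * G) ≤ ENNReal.ofReal ((C₀ + K₁) * G) :=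
            le_trans hbig h1
          rw [ENNReal.ofReal_le_ofReal_iff (by positivity)] at h2
          nlinarith
      _ ≤ _ := measure_union_le _ _
      _ ≤ _ := add_le_add hp₂ hp₁
      _ ≤ _ := by
          rw [← ENNReal.ofReal_add (by positivity) (by positivity), ← add_mul]
          apply ENNReal.ofReal_le_ofReal
          exact mul_le_mul_of_nonneg_right (by linarith) (Real.exp_pos _).le
  · calc _ ≤ P (SHE.chainBad σ u₀ u t (N / 2) B) := by
          refine measure_mono_ae ?_
          filter_upwards [hgood] with ω hω hbig
          by_contra hnot
          have h1 := (hω hnot).1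
          have h2 : ENNReal.ofReal (2 * N) ≤ ENNReal.ofReal (3 / 2 * N) :=
            le_trans hbig (iSup₂_le fun s hs ↦ hess s _ ω (h1 s hs.1 hs.2))
          rw [ENNReal.ofReal_le_ofReal_iff (by positivity)] at h2
          linarith
      _ ≤ _ := hp₂
      _ ≤ _ := by
          apply ENNReal.ofReal_le_ofReal
          -- The bad event already has the stronger bound with exponent -N^β.
          have h1 : -N ^ β ≤ -(1 / 2) * N ^ β := by linarith
          exact mul_le_mul (by linarith) (Real.exp_le_exp.2 h1) (Real.exp_pos _).le (by positivity)
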